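/- Theorem. There is a constant $c<2.63$ such that for every number of bidders $n\ge 1$, every regular value distribution $\mathcal F$ with a monopoly reserve $r^*$, and every joint distribution $\bm F$ of values $(v_1,\dots,v_n)$ that has all marginals equal to $\mathcal F$ and is pairwise independent, the second-price auction $\mathrm{AR}(r^*)$ with reserve $r^*$ (the highest bidder with bid at least $r^*$ wins and pays the maximum of $r^*$ and all other bids) satisfies $$c\cdot \mathrm{AR}(r^*)(\bm F)\;\ge\;\mathrm{AR}(r^*)(\mathcal F^{\otimes n})\qquad\text{and}\qquad c\cdot \mathrm{AR}(r^*)(\bm F)\;\ge\;\mathrm{OPT}(\mathcal F^{\otimes n}),$$ where $\mathrm{AR}(r^*)(\cdot)$ denotes expected total payment (which is finite under both $\bm F$ and the product prior $\mathcal F^{\otimes n}$), and $\mathrm{OPT}(\mathcal F^{\otimes n})$ is the supremum of the expected revenue over all single-item auctions that are Bayesian incentive compatible and interim individually rational for the independent prior $\mathcal F^{\otimes n}$. That is, Myerson's auction for identical regular marginals is pairwise-robust, and its revenue on any pairwise independent prior is more than a $1/2.63$ fraction of the optimal revenue under independence whenever the latter is positive. Here $\mathcal F$ is regular if, for some $0\le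 a\le b\le\infty$, it has a positive density $f$ on $(a,b)$, its remaining mass (if any) is an atom at $b<\infty$, and the virtual value $\varphi(x)=x-\Pr[v\ge x]/f(x)$ is weakly increasing on $(a,b)$. A monopoly reserve is a real $r^*\in[a,b]$ with $\varphi\le 0$ on $(a,b)\cap(-\infty,r^*)$ and $\varphi\ge0$ on $(a,b)\cap(r^*,\infty)$; for instance any $r^*\in(a,b)$ with $\varphi(r^*)=0$. -/

import Mathlib

open MeasureTheory ProbabilityTheory

noncomputable section

namespace PairwiseAuction

/-! ### Regular value distributions -/

/-- The quantile function `q(τ) = Pr[v ≥ τ]` of a value distribution `μ`. -/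
def quantile (μ : Measure ℝ) (τ : ℝ) : ℝ := μ.real (Set.Ici τ)

/-- The virtual value `φ(x) = x - q(x) / f(x)` of a distribution `μ` with density `f`. -/
def virtualValue (μ : Measure ℝ) (f : ℝ → ℝ) (x : ℝ) : ℝ := x - quantile μ x / f x

/-- The open interval `(a, b)` of the real line; the right endpoint may be `∞`. -/
def valueInterval (a : ℝ) (b : EReal) : Set ℝ := {x | a < x ∧ (x : EReal) < b}

/-- `μ` is a regular value distribution with support `[a, b]` (`[a, ∞)` when `b = ⊤`):
it has a positive density `f` on the open interval `(a, b)`, all remaining mass, if any, is an atom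
at the finite upper endpoint `b`, and the virtual value is (weakly) increasing on `(a, b)`.
For a distribution without atoms this is the usual definition; the atom at `b` allows for, e.g.,
equal revenue distributions truncated at `b`, and for a deterministic value when `a = b`. -/
structure IsRegular (μ : Measure ℝ) (a : ℝ) (b : EReal) (f : ℝ → ℝ) : Prop where
  left_nonneg : 0 ≤ a
  left_le_right : (a : EReal) ≤ b
  measurable_density : Measurable f
  density_pos : ∀ x ∈ valueInterval a b, 0 < f x
  restrict_eq : μ.restrict (valueInterval a b) =
    (volume.restrict (valueInterval a b)).withDensity fun x => ENNReal.ofReal (f x)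
  ae_mem : ∀ᵐ x ∂μ, x ∈ valueInterval a b ∨ (x : EReal) = b
  monotone_virtualValue : MonotoneOn (virtualValue μ f) (valueInterval a b)

/-- `r` is a monopoly reserve: a point of the support at which the virtual value changes sign from
nonpositive to nonnegative. For an interior point with `φ(r) = 0` this holds by regularity; `r` is
the lower endpoint when the virtual value is positive on the whole support, and the
upper endpoint (where there is then an atom) when it is negative on the whole of `(a, b)`. -/
structure IsMonopolyReserve (μ : Measure ℝ) (a : ℝ) (b : EReal) (f : ℝ → ℝ) (r : ℝ) : Prop where
  left_le : a ≤ r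
  le_right : (r : EReal) ≤ b
  nonpos_of_lt : ∀ x ∈ valueInterval a b, x < r → virtualValue μ f x ≤ 0
  nonneg_of_gt : ∀ x ∈ valueInterval a b, r < x → 0 ≤ virtualValue μ f x

/-! ### Priors -/

/-- The mutually independent prior of `n` bidders with identical marginals `μ`. -/
def iidPrior (μ : Measure ℝ) (n : ℕ) : Measure (Fin n → ℝ) := Measure.pi fun _ => μ

/-- `F` is a joint prior of `n` bidders with all marginals equal to `μ` under which the values of
any two different bidders are independent. -/
structure IsPairwiseIndepPrior {n : ℕ} (μ : Measure ℝ) (F : Measure (Fin n → ℝ)) : Prop where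
  isProbabilityMeasure : IsProbabilityMeasure F
  marginal : ∀ i, F.map (fun v => v i) = μ
  indep : ∀ i j, i ≠ j → IndepFun (fun v : Fin n → ℝ => v i) (fun v : Fin n → ℝ => v j) F

/-! ### Single-item auctions -/

/-- A direct single-item auction: given the bids, the winning probability and the payment of each
bidder. -/
structure Auction (n : ℕ) where
  alloc : (Fin n → ℝ) → Fin n → ℝ
  pay : (Fin n → ℝ) → Fin n → ℝ

namespace Auction

variable {n : ℕ}

/-- The total payment collected by the auctioneer. -/
def totalPay (A : Auction n) (v : Fin n → ℝ) : ℝ := ∑ i, A.pay v i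

/-- The expected revenue under truthful bidding when the values are drawn from `F`. -/
def revenue (A : Auction n) (F : Measure (Fin n → ℝ)) : ℝ := ∫ v, A.totalPay v ∂F

/-- The expected winning probability of bidder `i` with bid `b` when all other values are drawn
independently from `μ` (the `i`-th coordinate of `v` is overwritten by `b`). -/
def interimAlloc (A : Auction n) (μ : Measure ℝ) (i : Fin n) (b : ℝ) : ℝ :=
  ∫ v, A.alloc (Function.update v i b) i ∂(iidPrior μ n)

/-- The expected payment of bidder `i` with bid `b` when all other values are drawn independently
from `μ`. -/
def interimPay (A : Auction n) (μ : Measure ℝ) (i : Fin n) (b : ℝ) : ℝ :=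
  ∫ v, A.pay (Function.update v i b) i ∂(iidPrior μ n)

/-- `A` is a feasible single-item auction that is (Bayesian) incentive compatible and individually
rational for independent bidders with values drawn from `μ`: with `U_i(v, b)` the interim utility of
bidder `i` with value `v ≥ 0` and bid `b ≥ 0`, one has `U_i(v, v) ≥ U_i(v, b)` and
`U_i(v, v) ≥ 0`. Auctions with integrable payments that are truthful in dominant strategies are
included. -/
structure IsTruthful (A : Auction n) (μ : Measure ℝ) : Prop where
  measurable_alloc : ∀ i, Measurable fun b => A.alloc b i
  measurable_pay : ∀ i, Measurable fun b => A.pay b i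
  alloc_nonneg : ∀ b i, 0 ≤ A.alloc b i
  sum_alloc_le_one : ∀ b, ∑ i, A.alloc b i ≤ 1
  integrable_pay : ∀ i, Integrable (fun v => A.pay v i) (iidPrior μ n)
  integrable_interim : ∀ i, ∀ b : ℝ, 0 ≤ b →
    Integrable (fun v => A.pay (Function.update v i b) i) (iidPrior μ n)
  incentive_compatible : ∀ i, ∀ v b : ℝ, 0 ≤ v → 0 ≤ b →
    v * A.interimAlloc μ i b - A.interimPay μ i b ≤ v * A.interimAlloc μ i v - A.interimPay μ i v
  individually_rational : ∀ i, ∀ v : ℝ, 0 ≤ v →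
    0 ≤ v * A.interimAlloc μ i v - A.interimPay μ i v

end Auction

/-- The optimal expected revenue from `n` independent bidders with values drawn from `μ`: the
supremum over all truthful auctions. -/
def optimalRevenue (μ : Measure ℝ) (n : ℕ) : EReal :=
  ⨆ (A : Auction n) (_ : A.IsTruthful μ), ((A.revenue (iidPrior μ n) : ℝ) : EReal)

/-- Bidder `i` wins the second-price auction with reserve `r`: her bid is at least the reserve and
is the highest one, ties being broken in favour of the smallest index. -/
def IsWinner {n : ℕ} (r : ℝ) (b : Fin n → ℝ) (i : Fin n) : Prop :=
  r ≤ b i ∧ (∀ j, b j ≤ b i) ∧ ∀ j, j < i → b j < b i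

open Classical in
/-- The second-price auction with anonymous reserve `r`: the winner pays the maximum of the reserve
and all bids of the other bidders. -/
def secondPriceAuction (n : ℕ) (r : ℝ) : Auction n where
  alloc b i := if IsWinner r b i then 1 else 0
  pay b i := if IsWinner r b i then (Finset.univ.erase i).fold max r b else 0

end PairwiseAuction

end

/-! # Pairwise robustness of the second-price auction with monopoly reserve -/

namespace PairwiseAuction

/-! ### Numerical estimates -/

/-! Write `q` for the quantile function and let `X` count the values that are at least `τ`. Pairwise
independence fixes the mean of `X` to be `s = n q(τ)` and bounds its second moment by `s + s²`. The
proof uses nothing else about the joint prior, apart from integrability, which comes from tails of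
minima of two values.

Upper bound. `Auction.IsTruthful.revenue_le` relaxes the single-item constraint by a Lagrange
multiplier `c ≥ 0`: bidders are served separately at unit cost `c`, and each interim mechanism is a
mixture of posted prices (`integral_payment_le`). Regularity makes a price optimal when the virtual
value crosses the cost there (`IsRegular.profit_le`). If `n q(r) > 1`, let `P` be the largest price
with `n q(P) ≥ 1`; a suitable `c` then bounds every truthful revenue by `P`. If `n q(r) ≤ 1`, taking
`c = 0` gives the bound `r n q(r)`.

Lower bound. The auction earns at least `r` when some value reaches `r`, and at least `τ ≥ r` when
two values reach `τ`, so its revenue is at least `r Pr[some value ≥ r] + ∫ Pr[two values ≥ τ] dτ`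
over `[r, P]`. Above `r` the curve `τ q(τ)` decreases, hence `n q(τ) ≥ P / τ`. Moment inequalities
turn this into bounds on both probabilities in terms of `t = τ / P`, `x = r / P` and `p = Pr[no
value ≥ r]`. A large `p` hurts the first term but helps the second, because a sum with a given mean
that vanishes more often must also be large more often. Retaining `p` in both terms gives the
constant 2.62, checked on a grid of step `1 / 40` in `reserve_add_clippedSum_ge`. When `n q(r) ≤ 1`,
the first term alone loses only a factor 2. -/

/-- A lower bound for the probability that at least two values exceed a price at which at least
`1 / t` values do so in expectation. -/
noncomputable def twoBidders (t : ℝ) : ℝ := (1 - t) ^ 2 / (1 - t + t ^ 2)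

/-- The slope of the improvement of `twoBidders` in the probability that no value exceeds the
price. -/
noncomputable def twoBiddersSlope (t : ℝ) : ℝ :=
  2 * (t * (1 - t) / (1 - t + t ^ 2)) + (t * (1 - t) / (1 - t + t ^ 2)) ^ 2

/-- Riemann sum of `h` over `[x, 1]` for the grid of step `1 / 40`. -/
noncomputable def clippedSum (h : ℝ → ℝ) (x : ℝ) : ℝ :=
  ∑ j ∈ Finset.range 40, (max x (((j + 1 : ℕ) : ℝ) / 40) - max x ((j : ℝ) / 40)) *
    h (((j + 1 : ℕ) : ℝ) / 40)

lemma one_sub_add_sq_pos (t : ℝ) : 0 < 1 - t + t ^ 2 := by nlinarith [sq_nonneg (t - 1 / 2)]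

lemma twoBidders_nonneg (t : ℝ) : 0 ≤ twoBidders t :=
  div_nonneg (sq_nonneg _) (one_sub_add_sq_pos t).le

lemma twoBidders_le_one {t : ℝ} (ht : 0 ≤ t) : twoBidders t ≤ 1 := by
  rw [twoBidders, div_le_one (one_sub_add_sq_pos t)]
  nlinarith

lemma twoBiddersSlope_nonneg {t : ℝ} (h0 : 0 ≤ t) (h1 : t ≤ 1) : 0 ≤ twoBiddersSlope t := by
  have : 0 ≤ t * (1 - t) / (1 - t + t ^ 2) :=
    div_nonneg (mul_nonneg h0 (by linarith)) (one_sub_add_sq_pos t).le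
  unfold twoBiddersSlope
  positivity

lemma grid_mem {j : ℕ} (hj : j ∈ Finset.range 40) :
    0 ≤ (((j + 1 : ℕ) : ℝ) / 40) ∧ (((j + 1 : ℕ) : ℝ) / 40) ≤ 1 := by
  have : j + 1 ≤ 40 := by have := Finset.mem_range.1 hj; omega
  have : ((j + 1 : ℕ) : ℝ) ≤ 40 := by exact_mod_cast this
  constructor
  · positivity
  · linarith

/-- The difference is the length of the part of `[a, b]` to the right of the clipping point. -/
lemma max_sub_max_antitone {a b x y : ℝ} (hab : a ≤ b) (hxy : x ≤ y) :
    max y b - max y a ≤ max x b - max x a := by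
  rcases max_cases y b with h | h <;> rcases max_cases y a with h' | h' <;>
  rcases max_cases x b with h'' | h'' <;> rcases max_cases x a with h3 | h3 <;> linarith

lemma clippedSum_antitone {h : ℝ → ℝ} (hh : ∀ t, 0 ≤ t → t ≤ 1 → 0 ≤ h t) {x y : ℝ} (hxy : x ≤ y) :
    clippedSum h y ≤ clippedSum h x := by
  refine Finset.sum_le_sum fun j hj => mul_le_mul_of_nonneg_right ?_ ?_
  · refine max_sub_max_antitone ?_ hxy
    push_cast
    linarith
  · exact hh _ (grid_mem hj).1 (grid_mem hj).2

lemma clippedSum_nonneg {h : ℝ → ℝ} (hh : ∀ t, 0 ≤ t → t ≤ 1 → 0 ≤ h t) (x : ℝ) :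
    0 ≤ clippedSum h x := by
  refine Finset.sum_nonneg fun j hj => mul_nonneg ?_ (hh _ (grid_mem hj).1 (grid_mem hj).2)
  rw [sub_nonneg]
  refine max_le_max le_rfl ?_
  push_cast
  linarith

/-- Clipping discards cells of total length at most `x`, on which `h` is at most 1. -/
lemma clippedSum_zero_le {h : ℝ → ℝ} (hh : ∀ t, 0 ≤ t → h t ≤ 1) {x : ℝ} (hx : 0 ≤ x) :
    clippedSum h 0 ≤ x + clippedSum h x := by
  have key : ∀ m : ℕ, ∑ j ∈ Finset.range m,
      (max 0 (((j + 1 : ℕ) : ℝ) / 40) - max 0 ((j : ℝ) / 40)) * h (((j + 1 : ℕ) : ℝ) / 40) ≤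
      min x ((m : ℝ) / 40) + ∑ j ∈ Finset.range m,
      (max x (((j + 1 : ℕ) : ℝ) / 40) - max x ((j : ℝ) / 40)) * h (((j + 1 : ℕ) : ℝ) / 40) := by
    intro m
    induction m with
    | zero => simp [hx]
    | succ m ih =>
      rw [Finset.sum_range_succ, Finset.sum_range_succ]
      have e1 : max 0 (((m + 1 : ℕ) : ℝ) / 40) = ((m + 1 : ℕ) : ℝ) / 40 := max_eq_right (by positivity)
      have e2 : max 0 ((m : ℝ) / 40) = (m : ℝ) / 40 := max_eq_right (by positivity)
      have e3 := min_add_max x (((m + 1 : ℕ) : ℝ) / 40)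
      have e4 := min_add_max x ((m : ℝ) / 40)
      have h1 := hh (((m + 1 : ℕ) : ℝ) / 40) (by positivity)
      have hm : min x ((m : ℝ) / 40) ≤ min x (((m + 1 : ℕ) : ℝ) / 40) := by
        refine min_le_min le_rfl ?_
        push_cast
        linarith
      rw [e1, e2]
      nlinarith
  have h40 := key 40
  have := min_le_left x (((40 : ℕ) : ℝ) / 40)
  unfold clippedSum
  linarith

lemma clippedSum_eq_sum (h : ℝ → ℝ) {k : ℕ} (hk : k ≤ 40) :
    clippedSum h ((k : ℝ) / 40) =
      (∑ j ∈ Finset.Ico k 40, h (((j + 1 : ℕ) : ℝ) / 40)) / 40 := by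
  rw [clippedSum, ← Finset.sum_range_add_sum_Ico _ hk, Finset.sum_div]
  rw [Finset.sum_eq_zero, zero_add]
  · refine Finset.sum_congr rfl fun j hj => ?_
    have : (k : ℝ) ≤ j := by exact_mod_cast (Finset.mem_Ico.1 hj).1
    rw [max_eq_right, max_eq_right]
    · push_cast; ring
    · linarith
    · push_cast; linarith
  · intro j hj
    have : ((j + 1 : ℕ) : ℝ) ≤ k := by exact_mod_cast Finset.mem_range.1 hj
    rw [max_eq_left, max_eq_left, sub_self, zero_mul]
    · push_cast at this; linarith
    · linarith

lemma le_clippedSum_zero : 0.3825 ≤ clippedSum twoBidders 0 := by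
  have := clippedSum_eq_sum twoBidders (k := 0) (by norm_num)
  rw [Nat.cast_zero, zero_div] at this
  rw [this]
  simp only [twoBidders, Finset.sum_Ico_eq_sum_range, Finset.sum_range_succ, Finset.sum_range_zero]
  norm_num

lemma le_clippedSum_of_le {h : ℝ → ℝ} (hh : ∀ t, 0 ≤ t → t ≤ 1 → 0 ≤ h t) {k : ℕ} (hk : k ≤ 40)
    {x L : ℝ} (hx : x ≤ (k : ℝ) / 40) (hL : L ≤ (∑ j ∈ Finset.Ico k 40, h (((j + 1 : ℕ) : ℝ) / 40)) / 40) :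
    L ≤ clippedSum h x :=
  (hL.trans (clippedSum_eq_sum h hk).ge).trans (clippedSum_antitone hh hx)

/-- The expression is affine in `p` with slope `A - x`. If `A ≥ x`, the worst case is `p = 0`, where
`x + G` is at least the full sum 0.3825. Otherwise it is the largest admissible `p = x / (1 + x)`,
which leaves an inequality in `x` alone; as `A` and `G` are antitone, finitely many evaluations
suffice. -/
theorem reserve_add_clippedSum_ge {x p : ℝ} (hx0 : 0 ≤ x) (hp0 : 0 ≤ p)
    (hp : p * (1 + x) ≤ x) :
    1 / 2.62 ≤ x * (1 - p) + clippedSum twoBidders x + p * clippedSum twoBiddersSlope x := by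
  have hg : ∀ t : ℝ, 0 ≤ t → t ≤ 1 → 0 ≤ twoBidders t := fun t _ _ => twoBidders_nonneg t
  have hc : ∀ t : ℝ, 0 ≤ t → t ≤ 1 → 0 ≤ twoBiddersSlope t := fun t => twoBiddersSlope_nonneg
  have hG := clippedSum_nonneg hg x
  have hA := clippedSum_nonneg hc x
  set G := clippedSum twoBidders x with hGdef
  set A := clippedSum twoBiddersSlope x with hAdef
  have h0 : 0.3825 ≤ x + G := le_clippedSum_zero.trans
    (clippedSum_zero_le (fun t ht => twoBidders_le_one ht) hx0)
  rcases le_total x A with hxA | hxA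
  · have : 0 ≤ p * (A - x) := mul_nonneg hp0 (by linarith)
    norm_num at h0 ⊢
    linarith
  have main : (x * (1 + A) + G * (1 + x)) / (1 + x) ≤ x * (1 - p) + G + p * A := by
    rw [div_le_iff₀ (by linarith)]
    nlinarith
  refine le_trans ?_ main
  rw [le_div_iff₀ (by linarith)]
  rcases le_total x 0.3 with h3 | h3
  · have : 0.3 ≤ A := le_clippedSum_of_le hc (k := 12) (by norm_num) (by norm_num at h3 ⊢; linarith) (by
      simp only [twoBiddersSlope, Finset.sum_Ico_eq_sum_range, Finset.sum_range_succ,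
        Finset.sum_range_zero]
      norm_num)
    -- Here `0.3 ≤ A ≤ x ≤ 0.3`, so only the boundary point remains.
    have hx3 : x = 0.3 := le_antisymm h3 (by linarith)
    have hA3 : A = 0.3 := le_antisymm (by linarith) this
    rw [hx3] at h0 ⊢
    rw [hA3]
    norm_num at h0 ⊢
    linarith
  -- On `[lo, k / 40]` the sums are estimated at the right end, while the explicit `x` is replaced
  -- by the left end; this is allowed because the remaining slack has positive slope in `x`.
  have bound : ∀ (k : ℕ) (lo a g : ℝ), k ≤ 40 → lo ≤ x → x ≤ (k : ℝ) / 40 →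
      a ≤ (∑ j ∈ Finset.Ico k 40, twoBiddersSlope (((j + 1 : ℕ) : ℝ) / 40)) / 40 →
      g ≤ (∑ j ∈ Finset.Ico k 40, twoBidders (((j + 1 : ℕ) : ℝ) / 40)) / 40 →
      0 ≤ a → 0 ≤ g → 1 / 2.62 * (1 + lo) ≤ lo * (1 + a) + g * (1 + lo) →
      1 / 2.62 * (1 + x) ≤ x * (1 + A) + G * (1 + x) := by
    intro k lo a g hk hlo hhi ha hg' ha0 hg0 hnum
    have hA' : a ≤ A := le_clippedSum_of_le hc hk hhi ha
    have hG' : g ≤ G := le_clippedSum_of_le hg hk hhi hg'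
    have e1 : x * a ≤ x * A := mul_le_mul_of_nonneg_left hA' hx0
    have e2 : g * (1 + x) ≤ G * (1 + x) := mul_le_mul_of_nonneg_right hG' (by linarith)
    have e3 : 0 ≤ (x - lo) * (1 + a + g - 1 / 2.62) := by
      refine mul_nonneg (by linarith) ?_
      norm_num
      linarith
    linarith
  rcases le_total x 0.4 with h4 | h4
  · refine bound 16 0.3 0.3 0.087 (by norm_num) h3 (by norm_num at h4 ⊢; linarith) ?_ ?_
      (by norm_num) (by norm_num) (by norm_num)
    all_goals
      simp only [twoBidders, twoBiddersSlope, Finset.sum_Ico_eq_sum_range, Finset.sum_range_succ,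
        Finset.sum_range_zero]
      norm_num
  rcases le_total x 0.5 with h5 | h5
  · refine bound 20 0.4 0.2 0.045 (by norm_num) h4 (by norm_num at h5 ⊢; linarith) ?_ ?_
      (by norm_num) (by norm_num) (by norm_num)
    all_goals
      simp only [twoBidders, twoBiddersSlope, Finset.sum_Ico_eq_sum_range, Finset.sum_range_succ,
        Finset.sum_range_zero]
      norm_num
  rcases le_total x 0.625 with h6 | h6
  · refine bound 25 0.5 0.13 0.015 (by norm_num) h5 (by norm_num at h6 ⊢; linarith) ?_ ?_
      (by norm_num) (by norm_num) (by norm_num)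
    all_goals
      simp only [twoBidders, twoBiddersSlope, Finset.sum_Ico_eq_sum_range, Finset.sum_range_succ,
        Finset.sum_range_zero]
      norm_num
  -- For `x ≥ 0.625` the reserve term suffices, as `x / (1 + x) ≥ 5 / 13 > 1 / 2.62`.
  · have : 0 ≤ x * A := mul_nonneg hx0 hA
    have : 0 ≤ G * (1 + x) := mul_nonneg hG (by linarith)
    norm_num at h6 ⊢
    linarith

/-! ### The second-price auction, outcome by outcome -/

section SecondPrice

variable {n : ℕ} {r : ℝ} {b : Fin n → ℝ}

lemma IsWinner.unique {i j : Fin n} (hi : IsWinner r b i) (hj : IsWinner r b j) : i = j := by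
  rcases lt_trichotomy i j with h | h | h
  · exact absurd (hj.2.2 i h) (not_lt.2 (hi.2.1 j))
  · exact h
  · exact absurd (hi.2.2 j h) (not_lt.2 (hj.2.1 i))

lemma exists_isWinner {i : Fin n} (hi : r ≤ b i) : ∃ w, IsWinner r b w := by
  classical
  obtain ⟨m, -, hm⟩ := Finset.exists_max_image Finset.univ b ⟨i, Finset.mem_univ i⟩
  let S := Finset.univ.filter fun k => ∀ j, b j ≤ b k
  have hS : S.Nonempty := ⟨m, by simp [S]; intro j; exact hm j (Finset.mem_univ j)⟩
  have hw := Finset.min'_mem S hS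
  have hw' : ∀ j, b j ≤ b (S.min' hS) := (Finset.mem_filter.1 hw).2
  refine ⟨S.min' hS, hi.trans (hw' i), hw', fun j hj => lt_of_le_of_ne (hw' j) fun h => ?_⟩
  have : j ∈ S := by simp only [S, Finset.mem_filter, Finset.mem_univ, true_and, h]; exact hw'
  exact absurd (Finset.min'_le S j this) (not_le.2 hj)

/-- The price that bidder `i` has to pay when she wins. -/
noncomputable def winningPrice (r : ℝ) (b : Fin n → ℝ) (i : Fin n) : ℝ :=
  (Finset.univ.erase i).fold max r b

lemma reserve_le_winningPrice (i : Fin n) : r ≤ winningPrice r b i :=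
  Finset.le_fold_max r |>.2 (Or.inl le_rfl)

lemma le_winningPrice {i j : Fin n} (h : j ≠ i) : b j ≤ winningPrice r b i :=
  Finset.le_fold_max _ |>.2 (Or.inr ⟨j, by simp [h], le_rfl⟩)

lemma winningPrice_le {i : Fin n} {c : ℝ} (hr : r ≤ c) (h : ∀ j, j ≠ i → b j ≤ c) :
    winningPrice r b i ≤ c :=
  Finset.fold_max_le c |>.2 ⟨hr, fun j hj => h j (Finset.ne_of_mem_erase hj)⟩

lemma IsWinner.winningPrice_le {i : Fin n} (hi : IsWinner r b i) : winningPrice r b i ≤ b i :=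
  PairwiseAuction.winningPrice_le hi.1 fun j _ => hi.2.1 j

lemma le_winningPrice_of_not_isWinner {i : Fin n} (hi : ¬ IsWinner r b i) :
    b i ≤ winningPrice r b i := by
  by_contra! h
  refine hi ⟨((reserve_le_winningPrice i).trans_lt h).le, fun j => ?_, fun j hj => ?_⟩
  · rcases eq_or_ne j i with rfl | hj
    · exact le_rfl
    · exact ((le_winningPrice hj).trans_lt h).le
  · exact (le_winningPrice hj.ne).trans_lt h

lemma winningPrice_update (i : Fin n) (x : ℝ) :
    winningPrice r (Function.update b i x) i = winningPrice r b i := by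
  refine Finset.fold_congr fun j hj => ?_
  rw [Function.update_of_ne (Finset.ne_of_mem_erase hj)]

lemma secondPriceAuction_pay_of_isWinner {i : Fin n} (hi : IsWinner r b i) :
    (secondPriceAuction n r).pay b i = winningPrice r b i := if_pos hi

lemma secondPriceAuction_pay_of_not_isWinner {i : Fin n} (hi : ¬ IsWinner r b i) :
    (secondPriceAuction n r).pay b i = 0 := if_neg hi

lemma secondPriceAuction_alloc_of_isWinner {i : Fin n} (hi : IsWinner r b i) :
    (secondPriceAuction n r).alloc b i = 1 := if_pos hi

lemma secondPriceAuction_alloc_of_not_isWinner {i : Fin n} (hi : ¬ IsWinner r b i) :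
    (secondPriceAuction n r).alloc b i = 0 := if_neg hi

lemma secondPriceAuction_alloc_nonneg (b : Fin n → ℝ) (i : Fin n) :
    0 ≤ (secondPriceAuction n r).alloc b i := by
  by_cases h : IsWinner r b i
  · simp [secondPriceAuction_alloc_of_isWinner h]
  · simp [secondPriceAuction_alloc_of_not_isWinner h]

lemma secondPriceAuction_alloc_le_one (b : Fin n → ℝ) (i : Fin n) :
    (secondPriceAuction n r).alloc b i ≤ 1 := by
  by_cases h : IsWinner r b i
  · simp [secondPriceAuction_alloc_of_isWinner h]
  · simp [secondPriceAuction_alloc_of_not_isWinner h]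

lemma secondPriceAuction_sum_alloc_le_one (b : Fin n → ℝ) :
    ∑ i, (secondPriceAuction n r).alloc b i ≤ 1 := by
  by_cases h : ∃ w, IsWinner r b w
  · obtain ⟨w, hw⟩ := h
    rw [Finset.sum_eq_single w, secondPriceAuction_alloc_of_isWinner hw]
    · intro j _ hj
      exact secondPriceAuction_alloc_of_not_isWinner fun h => hj (h.unique hw)
    · simp
  · rw [Finset.sum_eq_zero]
    · exact zero_le_one
    · exact fun i _ => secondPriceAuction_alloc_of_not_isWinner fun hi => h ⟨i, hi⟩

lemma secondPriceAuction_pay_nonneg (hr : 0 ≤ r) (b : Fin n → ℝ) (i : Fin n) :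
    0 ≤ (secondPriceAuction n r).pay b i := by
  by_cases h : IsWinner r b i
  · rw [secondPriceAuction_pay_of_isWinner h]
    exact hr.trans (reserve_le_winningPrice i)
  · rw [secondPriceAuction_pay_of_not_isWinner h]

lemma secondPriceAuction_pay_le (b : Fin n → ℝ) (i : Fin n) :
    (secondPriceAuction n r).pay b i ≤ |b i| := by
  by_cases h : IsWinner r b i
  · rw [secondPriceAuction_pay_of_isWinner h]
    exact h.winningPrice_le.trans (le_abs_self _)
  · rw [secondPriceAuction_pay_of_not_isWinner h]
    exact abs_nonneg _

/-- Bidding one's value is a dominant strategy. -/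
lemma secondPriceAuction_utility_le (b : Fin n → ℝ) (i : Fin n) (v x : ℝ) :
    v * (secondPriceAuction n r).alloc (Function.update b i x) i -
        (secondPriceAuction n r).pay (Function.update b i x) i ≤
      v * (secondPriceAuction n r).alloc (Function.update b i v) i -
        (secondPriceAuction n r).pay (Function.update b i v) i := by
  have hv : max 0 (v - winningPrice r b i) ≤
      v * (secondPriceAuction n r).alloc (Function.update b i v) i -
        (secondPriceAuction n r).pay (Function.update b i v) i := by
    by_cases h : IsWinner r (Function.update b i v) i
    · rw [secondPriceAuction_pay_of_isWinner h, secondPriceAuction_alloc_of_isWinner h,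
        winningPrice_update]
      have := h.winningPrice_le
      rw [winningPrice_update, Function.update_self] at this
      rw [mul_one, max_eq_right (by linarith)]
    · rw [secondPriceAuction_pay_of_not_isWinner h, secondPriceAuction_alloc_of_not_isWinner h]
      have := le_winningPrice_of_not_isWinner h
      rw [winningPrice_update, Function.update_self] at this
      rw [max_eq_left (by linarith)]
      simp
  refine le_trans ?_ hv
  by_cases h : IsWinner r (Function.update b i x) i
  · rw [secondPriceAuction_pay_of_isWinner h, secondPriceAuction_alloc_of_isWinner h,
      winningPrice_update, mul_one]
    exact le_max_right _ _
  · rw [secondPriceAuction_pay_of_not_isWinner h, secondPriceAuction_alloc_of_not_isWinner h]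
    simp

lemma secondPriceAuction_utility_nonneg (b : Fin n → ℝ) (i : Fin n) (v : ℝ) :
    0 ≤ v * (secondPriceAuction n r).alloc (Function.update b i v) i -
        (secondPriceAuction n r).pay (Function.update b i v) i := by
  by_cases h : IsWinner r (Function.update b i v) i
  · rw [secondPriceAuction_pay_of_isWinner h, secondPriceAuction_alloc_of_isWinner h]
    have := h.winningPrice_le
    rw [Function.update_self] at this
    linarith
  · rw [secondPriceAuction_pay_of_not_isWinner h, secondPriceAuction_alloc_of_not_isWinner h]
    simp

lemma secondPriceAuction_totalPay_nonneg (hr : 0 ≤ r) (b : Fin n → ℝ) :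
    0 ≤ (secondPriceAuction n r).totalPay b :=
  Finset.sum_nonneg fun i _ => secondPriceAuction_pay_nonneg hr b i

lemma secondPriceAuction_pay_le_totalPay (hr : 0 ≤ r) (b : Fin n → ℝ) (i : Fin n) :
    (secondPriceAuction n r).pay b i ≤ (secondPriceAuction n r).totalPay b :=
  Finset.single_le_sum (f := fun i => (secondPriceAuction n r).pay b i)
    (fun i _ => secondPriceAuction_pay_nonneg hr b i) (Finset.mem_univ i)

lemma IsWinner.totalPay_eq {w : Fin n} (hw : IsWinner r b w) :
    (secondPriceAuction n r).totalPay b = winningPrice r b w := by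
  rw [Auction.totalPay, Finset.sum_eq_single w, secondPriceAuction_pay_of_isWinner hw]
  · exact fun j _ hj => secondPriceAuction_pay_of_not_isWinner fun h => hj (h.unique hw)
  · simp

lemma reserve_le_totalPay {i : Fin n} (hi : r ≤ b i) :
    r ≤ (secondPriceAuction n r).totalPay b := by
  obtain ⟨w, hw⟩ := exists_isWinner hi
  rw [hw.totalPay_eq]
  exact reserve_le_winningPrice w

/-- One of the two bidders is not the winner, and her bid enters the price. -/
lemma le_totalPay_of_two {i j : Fin n} (hij : i ≠ j) {τ : ℝ} (hτ : r ≤ τ) (hi : τ ≤ b i)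
    (hj : τ ≤ b j) : τ ≤ (secondPriceAuction n r).totalPay b := by
  obtain ⟨w, hw⟩ := exists_isWinner (hτ.trans hi)
  rw [hw.totalPay_eq]
  rcases eq_or_ne i w with rfl | h
  · exact hj.trans (le_winningPrice hij.symm)
  · exact hi.trans (le_winningPrice h)

/-- The price is the reserve or a losing bid, and a losing bid is its own minimum with the winning
bid. Bounding by minima of pairs matters because a single value may have infinite mean. -/
lemma totalPay_le (hr : 0 ≤ r) (b : Fin n → ℝ) :
    (secondPriceAuction n r).totalPay b ≤
      r + ∑ i, ∑ j ∈ Finset.univ.erase i, max 0 (min (b i) (b j)) := by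
  have hterm : ∀ i j : Fin n, 0 ≤ max 0 (min (b i) (b j)) := fun i j => le_max_left _ _
  have hrow : ∀ i : Fin n, 0 ≤ ∑ j ∈ Finset.univ.erase i, max 0 (min (b i) (b j)) :=
    fun i => Finset.sum_nonneg fun j _ => hterm i j
  have hsum : 0 ≤ ∑ i, ∑ j ∈ Finset.univ.erase i, max 0 (min (b i) (b j)) :=
    Finset.sum_nonneg fun i _ => hrow i
  by_cases h : ∃ w, IsWinner r b w
  · obtain ⟨w, hw⟩ := h
    rw [hw.totalPay_eq]
    refine winningPrice_le (by linarith) fun j hj => ?_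
    have h1 : max 0 (min (b w) (b j)) ≤ ∑ j ∈ Finset.univ.erase w, max 0 (min (b w) (b j)) :=
      Finset.single_le_sum (f := fun j => max 0 (min (b w) (b j))) (fun j _ => hterm w j)
        (by simp [hj])
    have h2 := Finset.single_le_sum
      (f := fun i => ∑ j ∈ Finset.univ.erase i, max 0 (min (b i) (b j))) (fun i _ => hrow i)
      (Finset.mem_univ w)
    have h3 := le_max_right 0 (min (b w) (b j))
    rw [min_eq_right (hw.2.1 j)] at h3 h1
    linarith
  · rw [Auction.totalPay, Finset.sum_eq_zero fun i _ =>
      secondPriceAuction_pay_of_not_isWinner fun hi => h ⟨i, hi⟩]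
    linarith

lemma measurableSet_isWinner (i : Fin n) : MeasurableSet {b : Fin n → ℝ | IsWinner r b i} := by
  unfold IsWinner
  refine MeasurableSet.inter (measurableSet_le measurable_const (measurable_pi_apply i))
    (MeasurableSet.inter ?_ ?_)
  · have : {b : Fin n → ℝ | ∀ j, b j ≤ b i} = ⋂ j, {b | b j ≤ b i} := by ext; simp
    change MeasurableSet {b : Fin n → ℝ | ∀ j, b j ≤ b i}
    rw [this]
    exact MeasurableSet.iInter fun j =>
      measurableSet_le (measurable_pi_apply j) (measurable_pi_apply i)
  · have : {b : Fin n → ℝ | ∀ j, j < i → b j < b i} = ⋂ j, ⋂ (_ : j < i), {b | b j < b i} := by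
      ext; simp
    change MeasurableSet {b : Fin n → ℝ | ∀ j, j < i → b j < b i}
    rw [this]
    exact MeasurableSet.iInter fun j => MeasurableSet.iInter fun _ =>
      measurableSet_lt (measurable_pi_apply j) (measurable_pi_apply i)

lemma measurable_secondPriceAuction_alloc (i : Fin n) :
    Measurable fun b => (secondPriceAuction n r).alloc b i :=
  Measurable.ite (measurableSet_isWinner i) measurable_const measurable_const

lemma measurable_fold_max (s : Finset (Fin n)) : Measurable fun b : Fin n → ℝ => s.fold max r b := by
  classical
  induction s using Finset.induction_on with
  | empty => simp
  | insert a s ha ih =>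
    simp only [Finset.fold_insert ha]
    exact (measurable_pi_apply a).max ih

lemma measurable_secondPriceAuction_pay (i : Fin n) :
    Measurable fun b => (secondPriceAuction n r).pay b i :=
  Measurable.ite (measurableSet_isWinner i) (measurable_fold_max _) measurable_const

lemma measurable_secondPriceAuction_totalPay :
    Measurable (secondPriceAuction n r).totalPay := by
  unfold Auction.totalPay
  exact Finset.measurable_fun_sum _ fun i _ => measurable_secondPriceAuction_pay i

end SecondPrice

/-! ### The number of values above a price -/

/-- The number of values that are at least `τ`. -/
noncomputable def numGe {n : ℕ} (τ : ℝ) (v : Fin n → ℝ) : ℕ :=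
  (Finset.univ.filter fun i => τ ≤ v i).card

section NumGe

variable {n : ℕ} {r τ : ℝ} {v : Fin n → ℝ}

lemma numGe_eq_sum (τ : ℝ) (v : Fin n → ℝ) :
    (numGe τ v : ℝ) = ∑ i, (Set.Ici τ).indicator (1 : ℝ → ℝ) (v i) := by
  rw [numGe, Finset.card_filter]
  push_cast
  refine Finset.sum_congr rfl fun i _ => ?_
  simp [Set.indicator_apply]

lemma numGe_le {σ : ℝ} (h : σ ≤ τ) (v : Fin n → ℝ) : numGe τ v ≤ numGe σ v :=
  Finset.card_le_card fun i hi => by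
    simp only [Finset.mem_filter, Finset.mem_univ, true_and] at hi ⊢
    exact h.trans hi

lemma measurable_numGe (τ : ℝ) : Measurable fun v : Fin n → ℝ => numGe τ v := by
  unfold numGe
  simp only [Finset.card_filter]
  exact Finset.measurable_fun_sum _ fun i _ =>
    Measurable.ite (measurableSet_le measurable_const (measurable_pi_apply i))
      measurable_const measurable_const

lemma reserve_le_totalPay_of_numGe (h : numGe r v ≠ 0) :
    r ≤ (secondPriceAuction n r).totalPay v := by
  obtain ⟨i, hi⟩ := Finset.card_ne_zero.1 h
  exact reserve_le_totalPay (Finset.mem_filter.1 hi).2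

lemma le_totalPay_of_numGe (hτ : r ≤ τ) (h : 2 ≤ numGe τ v) :
    τ ≤ (secondPriceAuction n r).totalPay v := by
  obtain ⟨i, hi, j, hj, hij⟩ := Finset.one_lt_card.1 (show 1 < numGe τ v from h)
  exact le_totalPay_of_two hij hτ (Finset.mem_filter.1 hi).2 (Finset.mem_filter.1 hj).2

/-- The revenue of the second-price auction bounded below by Riemann sums. -/
lemma reserve_add_sum_le_totalPay {σ : ℕ → ℝ} (hσ : Monotone σ) (h0 : σ 0 = r) (hr : 0 ≤ r) (m : ℕ)
    (v : Fin n → ℝ) :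
    r * (if numGe r v = 0 then 0 else 1) +
        ∑ j ∈ Finset.range m, (σ (j + 1) - σ j) * (if 2 ≤ numGe (σ (j + 1)) v then 1 else 0) ≤
      (secondPriceAuction n r).totalPay v := by
  have hle : ∀ j, r ≤ σ j := fun j => h0 ▸ hσ (Nat.zero_le j)
  by_cases hz : numGe r v = 0
  · rw [if_pos hz, Finset.sum_eq_zero]
    · simpa using secondPriceAuction_totalPay_nonneg hr v
    · intro j _
      rw [if_neg, mul_zero]
      have := numGe_le (hle (j + 1)) v
      omega
  rw [if_neg hz]
  have hT := reserve_le_totalPay_of_numGe hz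
  set T := (secondPriceAuction n r).totalPay v
  -- The truncation at `σ m` makes the induction work: a counted cell satisfies `σ (m + 1) ≤ T`, so
  -- the truncated payment grows by its full length.
  have key : ∑ j ∈ Finset.range m, (σ (j + 1) - σ j) *
      (if 2 ≤ numGe (σ (j + 1)) v then 1 else 0) ≤ min (σ m) T - r := by
    induction m with
    | zero => simp [h0, hT]
    | succ m ih =>
      rw [Finset.sum_range_succ]
      have hm := hσ (Nat.le_succ m)
      split_ifs with h
      · have := le_totalPay_of_numGe (hle (m + 1)) h
        rw [min_eq_left this]
        have := min_le_left (σ m) T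
        linarith
      · have := min_le_min hm (le_refl T)
        simp only [Nat.succ_eq_add_one] at this
        linarith
  have := min_le_right (σ m) T
  linarith

end NumGe

/-! ### Counting variables with the first two moments of a pairwise independent sum -/

section Moments

variable {Ω : Type*} [MeasurableSpace Ω] {F : Measure Ω} [IsProbabilityMeasure F] {X : Ω → ℕ}

lemma integrable_comp_of_le (hX : Measurable X) {N : ℕ} (hN : ∀ ω, X ω ≤ N) (g : ℕ → ℝ) :
    Integrable (fun ω => g (X ω)) F := by
  refine Integrable.of_bound ((measurable_from_nat (f := g)).comp hX).aestronglyMeasurable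
    (∑ k ∈ Finset.range (N + 1), ‖g k‖) (Filter.Eventually.of_forall fun ω => ?_)
  exact Finset.single_le_sum (f := fun k => ‖g k‖) (fun k _ => norm_nonneg _)
    (Finset.mem_range.2 (Nat.lt_succ_of_le (hN ω)))

omit [IsProbabilityMeasure F] in
lemma integral_ite_eq_zero_nonneg : 0 ≤ ∫ ω, (if X ω = 0 then (1 : ℝ) else 0) ∂F :=
  integral_nonneg fun ω => by dsimp only; split_ifs <;> norm_num

/-- Integrate `1[X = 0] ≤ (1 - yX)²`; the choice `y = 1 / (1 + s)` minimises the resulting bound. -/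
lemma integral_ite_eq_zero_mul_le (hX : Measurable X) {N : ℕ} (hN : ∀ ω, X ω ≤ N) {s : ℝ}
    (hs : 0 ≤ s) (h1 : ∫ ω, (X ω : ℝ) ∂F = s) (h2 : ∫ ω, (X ω : ℝ) ^ 2 ∂F ≤ s + s ^ 2) :
    (∫ ω, (if X ω = 0 then (1 : ℝ) else 0) ∂F) * (1 + s) ≤ 1 := by
  have hI := fun g => integrable_comp_of_le (F := F) hX hN g
  set y : ℝ := 1 / (1 + s) with hy
  have hys : y * (1 + s) = 1 := by rw [hy]; field_simp
  have hy0 : 0 ≤ y := by positivity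
  have hle : ∫ ω, (if X ω = 0 then (1 : ℝ) else 0) ∂F ≤
      ∫ ω, (1 - 2 * y * (X ω : ℝ) + y ^ 2 * (X ω : ℝ) ^ 2) ∂F := by
    refine integral_mono (hI fun k => if k = 0 then 1 else 0)
      (hI fun k => 1 - 2 * y * (k : ℝ) + y ^ 2 * (k : ℝ) ^ 2) fun ω => ?_
    dsimp only
    split_ifs with h
    · simp [h]
    · nlinarith [sq_nonneg (1 - y * (X ω : ℝ))]
  have hcalc : ∫ ω, (1 - 2 * y * (X ω : ℝ) + y ^ 2 * (X ω : ℝ) ^ 2) ∂F =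
      1 - 2 * y * s + y ^ 2 * ∫ ω, (X ω : ℝ) ^ 2 ∂F := by
    rw [integral_add (hI fun k => 1 - 2 * y * (k : ℝ)) (hI fun k => y ^ 2 * (k : ℝ) ^ 2),
      integral_sub (integrable_const _) (hI fun k => 2 * y * (k : ℝ)), integral_const_mul,
      integral_const_mul, h1]
    simp
  have h3 : y ^ 2 * ∫ ω, (X ω : ℝ) ^ 2 ∂F ≤ y ^ 2 * (s + s ^ 2) :=
    mul_le_mul_of_nonneg_left h2 (sq_nonneg y)
  have h4 : y ^ 2 * (s + s ^ 2) = y * s := by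
    calc y ^ 2 * (s + s ^ 2) = y * s * (y * (1 + s)) := by ring
      _ = y * s := by rw [hys, mul_one]
  have h5 : ∫ ω, (if X ω = 0 then (1 : ℝ) else 0) ∂F ≤ y := by nlinarith
  calc _ ≤ y * (1 + s) := mul_le_mul_of_nonneg_right h5 (by linarith)
    _ = 1 := hys

/-- This is Cauchy–Schwarz for `(X - 1)⁺`, linearised in a parameter `y`. Pointwise, `1[X ≥ 2]`
dominates `1 - (1 - y(X - 1))²` with a correction at `X = 0`, where `X - 1` is negative. -/
lemma integral_ite_two_le_ge (hX : Measurable X) {N : ℕ} (hN : ∀ ω, X ω ≤ N) {s : ℝ}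
    (h1 : ∫ ω, (X ω : ℝ) ∂F = s) (h2 : ∫ ω, (X ω : ℝ) ^ 2 ∂F ≤ s + s ^ 2) (y : ℝ) :
    2 * y * (s - 1 + ∫ ω, (if X ω = 0 then (1 : ℝ) else 0) ∂F) -
      y ^ 2 * (s ^ 2 - s + 1 - ∫ ω, (if X ω = 0 then (1 : ℝ) else 0) ∂F) ≤
      ∫ ω, (if 2 ≤ X ω then (1 : ℝ) else 0) ∂F := by
  have hI := fun g => integrable_comp_of_le (F := F) hX hN g
  set p := ∫ ω, (if X ω = 0 then (1 : ℝ) else 0) ∂F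
  have hle : ∫ ω, ((2 * y + y ^ 2) * (if X ω = 0 then (1 : ℝ) else 0) +
        (2 * y + 2 * y ^ 2) * (X ω : ℝ) - y ^ 2 * (X ω : ℝ) ^ 2 - (2 * y + y ^ 2)) ∂F ≤
      ∫ ω, (if 2 ≤ X ω then (1 : ℝ) else 0) ∂F := by
    refine integral_mono (hI fun k => (2 * y + y ^ 2) * (if k = 0 then (1 : ℝ) else 0) +
        (2 * y + 2 * y ^ 2) * (k : ℝ) - y ^ 2 * (k : ℝ) ^ 2 - (2 * y + y ^ 2))
      (hI fun k => if 2 ≤ k then 1 else 0) fun ω => ?_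
    dsimp only
    rcases Nat.lt_or_ge (X ω) 2 with h | h
    · have : X ω = 0 ∨ X ω = 1 := by omega
      rcases this with h | h
      · simp [h]
      · simp [h]
        linarith
    · rw [if_pos h, if_neg (by omega)]
      nlinarith [sq_nonneg (1 - y * ((X ω : ℝ) - 1))]
  refine le_trans ?_ hle
  rw [integral_sub (hI fun k => (2 * y + y ^ 2) * (if k = 0 then (1 : ℝ) else 0) +
        (2 * y + 2 * y ^ 2) * (k : ℝ) - y ^ 2 * (k : ℝ) ^ 2) (integrable_const _),
      integral_sub (hI fun k => (2 * y + y ^ 2) * (if k = 0 then (1 : ℝ) else 0) +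
        (2 * y + 2 * y ^ 2) * (k : ℝ)) (hI fun k => y ^ 2 * (k : ℝ) ^ 2),
      integral_add (hI fun k => (2 * y + y ^ 2) * (if k = 0 then (1 : ℝ) else 0))
        (hI fun k => (2 * y + 2 * y ^ 2) * (k : ℝ)),
      integral_const_mul, integral_const_mul, integral_const_mul, h1]
  have h3 := mul_le_mul_of_nonneg_left h2 (sq_nonneg y)
  simp only [integral_const, probReal_univ, smul_eq_mul, one_mul]
  change _ ≤ (2 * y + y ^ 2) * p + _ - _ - _
  linarith

/-- The best `y` in `integral_ite_two_le_ge` gives `(s - 1 + p)² / (s² - s + 1 - p)`. This increases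
in `s` because `p ≤ 1 / 2`, so `s` may be lowered to `u = 1 / t`. Using there the multiplier `w`
that is optimal for `p = 0` yields a bound affine in `p`, the tangent at `p = 0`. -/
theorem twoBidders_le_integral (hX : Measurable X) {N : ℕ} (hN : ∀ ω, X ω ≤ N) {s t : ℝ}
    (h1 : ∫ ω, (X ω : ℝ) ∂F = s) (h2 : ∫ ω, (X ω : ℝ) ^ 2 ∂F ≤ s + s ^ 2) (ht0 : 0 < t)
    (ht1 : t ≤ 1) (hst : 1 ≤ s * t) :
    twoBidders t + twoBiddersSlope t * ∫ ω, (if X ω = 0 then (1 : ℝ) else 0) ∂F ≤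
      ∫ ω, (if 2 ≤ X ω then (1 : ℝ) else 0) ∂F := by
  have hs : 1 ≤ s := by nlinarith
  have hp0 := integral_ite_eq_zero_nonneg (F := F) (X := X)
  have hp := integral_ite_eq_zero_mul_le hX hN (by linarith) h1 h2
  have hB := integral_ite_two_le_ge hX hN h1 h2
  set p := ∫ ω, (if X ω = 0 then (1 : ℝ) else 0) ∂F
  set B := ∫ ω, (if 2 ≤ X ω then (1 : ℝ) else 0) ∂F
  have hp2 : p ≤ 1 / 2 := by nlinarith
  set u : ℝ := 1 / t with hu
  have hut : u * t = 1 := by rw [hu]; field_simp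
  have hu1 : 1 ≤ u := by rw [hu, le_div_iff₀ ht0]; linarith
  have hus : u ≤ s := by rw [hu, div_le_iff₀ ht0]; exact hst
  have hD : 0 < s ^ 2 - s + 1 - p := by nlinarith
  have hDu : 0 < u ^ 2 - u + 1 - p := by nlinarith
  have hratio : (s - 1 + p) ^ 2 / (s ^ 2 - s + 1 - p) ≤ B := by
    refine le_of_eq_of_le ?_ (hB ((s - 1 + p) / (s ^ 2 - s + 1 - p)))
    field_simp
    ring
  have hmono : (u - 1 + p) ^ 2 / (u ^ 2 - u + 1 - p) ≤ (s - 1 + p) ^ 2 / (s ^ 2 - s + 1 - p) := by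
    rw [div_le_div_iff₀ hDu hD]
    have e1 : 0 ≤ (u - 1 + p) * (u * (1 - 2 * p) + (1 - p)) := by
      refine mul_nonneg (by linarith) (add_nonneg (mul_nonneg (by linarith) ?_) ?_) <;> linarith
    have e2 : 0 ≤ (s - u) * (u * (1 - 2 * p) + p * (1 - p)) := by
      refine mul_nonneg (by linarith) (add_nonneg (mul_nonneg (by linarith) ?_) (mul_nonneg hp0 ?_))
        <;> linarith
    have e3 := mul_nonneg (sub_nonneg.2 hus) (add_nonneg e1 e2)
    linarith
  set w : ℝ := t * (1 - t) / (1 - t + t ^ 2) with hw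
  have htan : 2 * w * (u - 1 + p) - w ^ 2 * (u ^ 2 - u + 1 - p) ≤
      (u - 1 + p) ^ 2 / (u ^ 2 - u + 1 - p) := by
    rw [le_div_iff₀ hDu]
    nlinarith [sq_nonneg ((u - 1 + p) - w * (u ^ 2 - u + 1 - p))]
  have heq : twoBidders t + twoBiddersSlope t * p =
      2 * w * (u - 1 + p) - w ^ 2 * (u ^ 2 - u + 1 - p) := by
    have := (one_sub_add_sq_pos t).ne'
    rw [twoBidders, twoBiddersSlope, hw, hu]
    field_simp
    ring
  rw [heq]
  exact htan.trans (hmono.trans hratio)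

end Moments

/-! ### Pairwise independent priors -/

namespace IsPairwiseIndepPrior

variable {n : ℕ} {μ : Measure ℝ} {F : Measure (Fin n → ℝ)}

lemma measure_le_apply (hF : IsPairwiseIndepPrior μ F) (i : Fin n) (τ : ℝ) :
    F {v | τ ≤ v i} = μ (Set.Ici τ) := by
  rw [← hF.marginal i, Measure.map_apply (measurable_pi_apply i) measurableSet_Ici]
  rfl

lemma measure_le_apply_inter (hF : IsPairwiseIndepPrior μ F) {i j : Fin n} (hij : i ≠ j) (τ : ℝ) :
    F ({v | τ ≤ v i} ∩ {v | τ ≤ v j}) = μ (Set.Ici τ) * μ (Set.Ici τ) := by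
  have := (hF.indep i j hij).measure_inter_preimage_eq_mul (Set.Ici τ) (Set.Ici τ)
    measurableSet_Ici measurableSet_Ici
  exact this.trans (congrArg₂ _ (hF.measure_le_apply i τ) (hF.measure_le_apply j τ))

lemma integral_indicator (hF : IsPairwiseIndepPrior μ F) (i : Fin n) (τ : ℝ) :
    ∫ v, (Set.Ici τ).indicator (1 : ℝ → ℝ) (v i) ∂F = quantile μ τ := by
  have : (fun v : Fin n → ℝ => (Set.Ici τ).indicator (1 : ℝ → ℝ) (v i)) =
      {v : Fin n → ℝ | τ ≤ v i}.indicator 1 := by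
    ext v; simp [Set.indicator_apply]
  rw [this, integral_indicator_one (measurableSet_le measurable_const (measurable_pi_apply i)),
    quantile, measureReal_def, measureReal_def, hF.measure_le_apply]

/-- Off the diagonal this is pairwise independence. On the diagonal the square of the indicator is
itself, and the term `q²` is slack that makes the double sum uniform. -/
lemma integral_indicator_mul (hF : IsPairwiseIndepPrior μ F) (i j : Fin n) (τ : ℝ) :
    ∫ v, (Set.Ici τ).indicator (1 : ℝ → ℝ) (v i) * (Set.Ici τ).indicator (1 : ℝ → ℝ) (v j) ∂F ≤
      quantile μ τ ^ 2 + if i = j then quantile μ τ else 0 := by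
  have hm : ∀ i : Fin n, MeasurableSet {v : Fin n → ℝ | τ ≤ v i} := fun i =>
    measurableSet_le measurable_const (measurable_pi_apply i)
  rcases eq_or_ne i j with rfl | hij
  · have : (fun v : Fin n → ℝ => (Set.Ici τ).indicator (1 : ℝ → ℝ) (v i) *
        (Set.Ici τ).indicator (1 : ℝ → ℝ) (v i)) =
        fun v => (Set.Ici τ).indicator (1 : ℝ → ℝ) (v i) := by
      ext v; simp [Set.indicator_apply]
    rw [this, hF.integral_indicator, if_pos rfl]
    nlinarith [sq_nonneg (quantile μ τ)]
  · have : (fun v : Fin n → ℝ => (Set.Ici τ).indicator (1 : ℝ → ℝ) (v i) *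
        (Set.Ici τ).indicator (1 : ℝ → ℝ) (v j)) =
        ({v : Fin n → ℝ | τ ≤ v i} ∩ {v | τ ≤ v j}).indicator 1 := by
      ext v; simp [Set.indicator_apply, ← ite_and, and_comm]
    rw [this, integral_indicator_one ((hm i).inter (hm j)), if_neg hij, measureReal_def,
      hF.measure_le_apply_inter hij, ENNReal.toReal_mul, quantile, measureReal_def]
    exact le_of_eq (by ring)

lemma integral_numGe (hF : IsPairwiseIndepPrior μ F) (τ : ℝ) :
    ∫ v, (numGe τ v : ℝ) ∂F = n * quantile μ τ := by
  have := hF.isProbabilityMeasure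
  simp only [numGe_eq_sum]
  rw [integral_finsetSum]
  · simp [hF.integral_indicator]
  · intro i _
    exact Integrable.of_bound ((measurable_one.indicator measurableSet_Ici).comp
      (measurable_pi_apply i)).aestronglyMeasurable 1 (Filter.Eventually.of_forall fun v => by
        simp only [Set.indicator_apply]; split_ifs <;> simp)

lemma integral_numGe_sq_le (hF : IsPairwiseIndepPrior μ F) (τ : ℝ) :
    ∫ v, (numGe τ v : ℝ) ^ 2 ∂F ≤ n * quantile μ τ + (n * quantile μ τ) ^ 2 := by
  have := hF.isProbabilityMeasure
  simp only [numGe_eq_sum, sq (∑ i, _), Finset.sum_mul_sum]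
  have hint : ∀ i j : Fin n, Integrable (fun v : Fin n → ℝ =>
      (Set.Ici τ).indicator (1 : ℝ → ℝ) (v i) * (Set.Ici τ).indicator (1 : ℝ → ℝ) (v j)) F := by
    intro i j
    refine Integrable.of_bound (((measurable_one.indicator measurableSet_Ici).comp
      (measurable_pi_apply i)).mul ((measurable_one.indicator measurableSet_Ici).comp
      (measurable_pi_apply j))).aestronglyMeasurable 1 (Filter.Eventually.of_forall fun v => ?_)
    simp only [Set.indicator_apply]
    split_ifs <;> simp
  rw [integral_finsetSum _ fun i _ => integrable_finsetSum _ fun j _ => hint i j]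
  simp only [integral_finsetSum _ fun j _ => hint _ j]
  refine (Finset.sum_le_sum fun i _ => Finset.sum_le_sum fun j _ =>
    hF.integral_indicator_mul i j τ).trans (le_of_eq ?_)
  simp [Finset.sum_add_distrib]
  ring

lemma numGe_le_card (τ : ℝ) (v : Fin n → ℝ) : numGe τ v ≤ n :=
  (Finset.card_le_univ _).trans (by simp)

/-- In units of `P`, the reserve is `x` and the hypothesis `hq` says that at price `tP` at least `1
/ t` values are expected. The Riemann sum over `[x, 1]` is then bounded cell by cell, with the same
`p` in every cell. -/
theorem le_mul_revenue (hF : IsPairwiseIndepPrior μ F) {r P : ℝ} (hr : 0 ≤ r) (hP : 0 < P)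
    (hrP : r ≤ P) (hq : ∀ τ, r ≤ τ → τ ≤ P → P ≤ τ * (n * quantile μ τ))
    (hint : Integrable (secondPriceAuction n r).totalPay F) :
    P ≤ 2.62 * (secondPriceAuction n r).revenue F := by
  have := hF.isProbabilityMeasure
  have hI := fun (τ : ℝ) (g : ℕ → ℝ) => integrable_comp_of_le (F := F) (measurable_numGe τ)
    (numGe_le_card (n := n) τ) g
  set x : ℝ := r / P with hx
  have hxP : x * P = r := by rw [hx]; field_simp
  have hx0 : 0 ≤ x := by positivity
  set p := ∫ v, (if numGe r v = 0 then (1 : ℝ) else 0) ∂F with hp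
  have hp0 : 0 ≤ p := integral_ite_eq_zero_nonneg
  have hs0 : ∀ τ, 0 ≤ n * quantile μ τ := fun τ =>
    mul_nonneg (Nat.cast_nonneg n) measureReal_nonneg
  have hp1 : p * (1 + n * quantile μ r) ≤ 1 :=
    integral_ite_eq_zero_mul_le (measurable_numGe r) (numGe_le_card r) (hs0 r)
    (hF.integral_numGe r) (hF.integral_numGe_sq_le r)
  -- At the reserve the expected count is at least `1 / x`, which limits `p` to `x / (1 + x)`.
  have hpx : p * (1 + x) ≤ x := by
    have h1 := hq r le_rfl hrP
    have h2 : p * (r + P) ≤ r := by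
      calc p * (r + P) ≤ p * (r + r * (n * quantile μ r)) :=
            mul_le_mul_of_nonneg_left (by linarith) hp0
        _ = r * (p * (1 + n * quantile μ r)) := by ring
        _ ≤ r * 1 := mul_le_mul_of_nonneg_left hp1 hr
        _ = r := mul_one r
    have h3 : p * (1 + x) * P ≤ x * P := by
      calc p * (1 + x) * P = p * (x * P + P) := by ring
        _ ≤ x * P := by rw [hxP]; exact h2
    exact le_of_mul_le_mul_right h3 hP
  set σ : ℕ → ℝ := fun j => P * max x ((j : ℝ) / 40) with hσ
  have hσmono : Monotone σ := fun i j hij => by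
    have : (i : ℝ) ≤ j := by exact_mod_cast hij
    exact mul_le_mul_of_nonneg_left (max_le_max le_rfl (by linarith)) hP.le
  have hσ0 : σ 0 = r := by simp [hσ, max_eq_left hx0, mul_comm P, hxP]
  have hle : ∫ v, (r * (if numGe r v = 0 then 0 else 1) +
        ∑ j ∈ Finset.range 40, (σ (j + 1) - σ j) * (if 2 ≤ numGe (σ (j + 1)) v then 1 else 0)) ∂F ≤
      (secondPriceAuction n r).revenue F :=
    integral_mono (((hI r fun k => if k = 0 then 0 else 1).const_mul r).add
      (integrable_finsetSum _ fun j _ =>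
        (hI (σ (j + 1)) fun k => if 2 ≤ k then 1 else 0).const_mul _)) hint
      fun v => reserve_add_sum_le_totalPay hσmono hσ0 hr 40 v
  rw [integral_add ((hI r fun k => if k = 0 then 0 else 1).const_mul r) (integrable_finsetSum _
      fun j _ => (hI (σ (j + 1)) fun k => if 2 ≤ k then 1 else 0).const_mul _),
    integral_finsetSum _ fun j _ => (hI (σ (j + 1)) fun k => if 2 ≤ k then 1 else 0).const_mul _,
    integral_const_mul] at hle
  simp only [integral_const_mul] at hle
  have hone : ∫ v, (if numGe r v = 0 then (0 : ℝ) else 1) ∂F = 1 - p := by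
    have : (fun v : Fin n → ℝ => if numGe r v = 0 then (0 : ℝ) else 1) =
        fun v => 1 - (if numGe r v = 0 then (1 : ℝ) else 0) := by
      ext v; split_ifs <;> simp
    rw [this, integral_sub (integrable_const _) (hI r fun k => if k = 0 then 1 else 0)]
    simp [hp]
  have hterm : ∀ j ∈ Finset.range 40,
      P * ((max x (((j + 1 : ℕ) : ℝ) / 40) - max x ((j : ℝ) / 40)) *
        (twoBidders (((j + 1 : ℕ) : ℝ) / 40) + twoBiddersSlope (((j + 1 : ℕ) : ℝ) / 40) * p)) ≤
      (σ (j + 1) - σ j) * ∫ v, (if 2 ≤ numGe (σ (j + 1)) v then (1 : ℝ) else 0) ∂F := by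
    intro j hj
    set t : ℝ := ((j + 1 : ℕ) : ℝ) / 40 with ht
    have ht0 : 0 < t := by positivity
    have ht1 : t ≤ 1 := (grid_mem hj).2
    have hjt : (j : ℝ) / 40 ≤ t := by rw [ht]; push_cast; linarith
    -- Cells below the reserve are clipped to length zero; the probability bound is needed only for
    -- the others.
    rcases le_total t x with hxt | hxt
    · have e1 : σ (j + 1) - σ j = 0 := by
        simp only [hσ]
        rw [← ht, max_eq_left hxt, max_eq_left (hjt.trans hxt), sub_self]
      rw [e1, max_eq_left hxt, max_eq_left (hjt.trans hxt), sub_self]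
      simp
    · have e1 : σ (j + 1) = P * t := by simp only [hσ]; rw [← ht, max_eq_right hxt]
      have hrt : r ≤ P * t := by rw [← hxP, mul_comm]; exact mul_le_mul_of_nonneg_left hxt hP.le
      have hst : 1 ≤ n * quantile μ (P * t) * t := by
        have h1 := hq (P * t) hrt (by nlinarith)
        refine le_of_mul_le_mul_left (a := P) ?_ hP
        linarith
      have h2 := twoBidders_le_integral (measurable_numGe (P * t)) (numGe_le_card (P * t))
        (hF.integral_numGe (P * t)) (hF.integral_numGe_sq_le (P * t)) ht0 ht1 hst
      have hpp : p ≤ ∫ v, (if numGe (P * t) v = 0 then (1 : ℝ) else 0) ∂F := by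
        refine integral_mono (hI r fun k => if k = 0 then 1 else 0)
          (hI (P * t) fun k => if k = 0 then 1 else 0) fun v => ?_
        have := numGe_le hrt v
        dsimp only
        split_ifs with h1 h2
        · exact le_rfl
        · omega
        · exact zero_le_one
        · exact le_rfl
      have h3 := mul_le_mul_of_nonneg_left hpp (twoBiddersSlope_nonneg ht0.le ht1)
      have h4 : 0 ≤ σ (j + 1) - σ j := sub_nonneg.2 (hσmono (Nat.le_succ j))
      calc _ = (σ (j + 1) - σ j) * (twoBidders t + twoBiddersSlope t * p) := by
            simp only [hσ]; rw [← ht]; ring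
        _ ≤ _ := mul_le_mul_of_nonneg_left (by rw [e1]; linarith) h4
  have hsum := Finset.sum_le_sum hterm
  have hnum := mul_le_mul_of_nonneg_left (reserve_add_clippedSum_ge hx0 hp0 hpx) hP.le
  have heq : P * (x * (1 - p) + clippedSum twoBidders x + p * clippedSum twoBiddersSlope x) =
      r * (1 - p) + ∑ j ∈ Finset.range 40,
      P * ((max x (((j + 1 : ℕ) : ℝ) / 40) - max x ((j : ℝ) / 40)) *
        (twoBidders (((j + 1 : ℕ) : ℝ) / 40) + twoBiddersSlope (((j + 1 : ℕ) : ℝ) / 40) * p)) := by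
    rw [← hxP, clippedSum, clippedSum, mul_add, mul_add, Finset.mul_sum, Finset.mul_sum,
      Finset.mul_sum, add_assoc, ← Finset.sum_add_distrib]
    congr 1
    · ring
    · exact Finset.sum_congr rfl fun j _ => by ring
  rw [hone] at hle
  rw [heq] at hnum
  have : P * (1 / 2.62) ≤ (secondPriceAuction n r).revenue F := by linarith
  norm_num at this ⊢
  linarith

/-- When at most one value exceeds the reserve in expectation, the reserve alone secures half of
the revenue of the ex-ante relaxation. -/
theorem mul_quantile_le_two_mul_revenue (hF : IsPairwiseIndepPrior μ F) {r : ℝ} (hr : 0 ≤ r)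
    (hs : n * quantile μ r ≤ 1) (hint : Integrable (secondPriceAuction n r).totalPay F) :
    r * (n * quantile μ r) ≤ 2 * (secondPriceAuction n r).revenue F := by
  have := hF.isProbabilityMeasure
  have hI := fun (g : ℕ → ℝ) => integrable_comp_of_le (F := F) (measurable_numGe r)
    (numGe_le_card (n := n) r) g
  set p := ∫ v, (if numGe r v = 0 then (1 : ℝ) else 0) ∂F with hp
  set s := n * quantile μ r with hsdef
  have hs0 : 0 ≤ s := mul_nonneg (Nat.cast_nonneg n) measureReal_nonneg
  have hp1 : p * (1 + s) ≤ 1 :=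
    integral_ite_eq_zero_mul_le (measurable_numGe r) (numGe_le_card r) hs0
    (hF.integral_numGe r) (hF.integral_numGe_sq_le r)
  have hp0 : 0 ≤ p := integral_ite_eq_zero_nonneg
  have hle : ∫ v, (r * (1 - if numGe r v = 0 then (1 : ℝ) else 0)) ∂F ≤
      (secondPriceAuction n r).revenue F := by
    refine integral_mono (hI fun k => r * (1 - if k = 0 then (1 : ℝ) else 0)) hint fun v => ?_
    dsimp only
    split_ifs with h
    · simpa using secondPriceAuction_totalPay_nonneg hr v
    · simpa using reserve_le_totalPay_of_numGe h
  rw [integral_const_mul, integral_sub (integrable_const _) (hI fun k => if k = 0 then 1 else 0)]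
    at hle
  have h1 : s ≤ 2 * (1 - p) := by nlinarith
  have h2 := mul_le_mul_of_nonneg_left h1 hr
  simp only [integral_const, probReal_univ, smul_eq_mul, mul_one] at hle
  change r * (1 - p) ≤ _ at hle
  linarith

end IsPairwiseIndepPrior

/-! ### Regular distributions -/

/-- A function whose increments are bounded below up to an error of second order is increasing. -/
theorem le_of_forall_sub_le {G m : ℝ → ℝ} {x y : ℝ} (hxy : x ≤ y)
    (h : ∀ u v, x ≤ u → u ≤ v → v ≤ y → G u - G v ≤ (v - u) * (m v - m u)) : G x ≤ G y := by
  -- Over `N + 1` equal steps the errors telescope to the total increment of `m` times the step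
  -- length. Neither function need be continuous.
  have key : ∀ N : ℕ, G x - G y ≤ ((y - x) * (m y - m x)) / (N + 1 : ℕ) := by
    intro N
    set δ : ℝ := (y - x) / (N + 1 : ℕ) with hδ
    have hN : (0 : ℝ) < ((N + 1 : ℕ) : ℝ) := by positivity
    have hδ0 : 0 ≤ δ := div_nonneg (by linarith) hN.le
    have hδN : ((N + 1 : ℕ) : ℝ) * δ = y - x := by rw [hδ]; field_simp
    set z : ℕ → ℝ := fun k => x + k * δ with hz
    have h0 : z 0 = x := by simp [hz]
    have hN1 : z (N + 1) = y := by simp only [hz]; rw [hδN]; ring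
    have hstep : ∀ k, z (k + 1) - z k = δ := by intro k; simp only [hz]; push_cast; ring
    have hsum : ∑ k ∈ Finset.range (N + 1), (G (z k) - G (z (k + 1))) ≤
        ∑ k ∈ Finset.range (N + 1), δ * (m (z (k + 1)) - m (z k)) := by
      refine Finset.sum_le_sum fun k hk => ?_
      rw [← hstep k]
      refine h _ _ ?_ (by linarith [hstep k]) ?_
      · simp only [hz]; nlinarith [(Nat.cast_nonneg k : (0 : ℝ) ≤ k)]
      · rw [← hN1]
        have : ((k + 1 : ℕ) : ℝ) ≤ ((N + 1 : ℕ) : ℝ) := by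
          exact_mod_cast Finset.mem_range.1 hk
        simp only [hz]
        nlinarith
    rw [Finset.sum_range_sub' (fun k => G (z k)), ← Finset.mul_sum,
      Finset.sum_range_sub (fun k => m (z k)), h0, hN1] at hsum
    calc _ ≤ _ := hsum
      _ = _ := by rw [hδ]; ring
  have hlim : Filter.Tendsto (fun N : ℕ => ((y - x) * (m y - m x)) / (N + 1 : ℕ)) Filter.atTop
      (nhds 0) :=
    (tendsto_const_div_atTop_nhds_zero_nat _).comp (Filter.tendsto_add_atTop_nat 1)
  have := ge_of_tendsto' hlim key
  linarith

section Quantile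

variable {μ : Measure ℝ} [IsProbabilityMeasure μ]

omit [IsProbabilityMeasure μ] in
lemma quantile_nonneg (x : ℝ) : 0 ≤ quantile μ x := measureReal_nonneg

lemma quantile_le_one (x : ℝ) : quantile μ x ≤ 1 := measureReal_le_one

lemma quantile_antitone : Antitone (quantile μ) := fun _ _ h =>
  measureReal_mono (Set.Ici_subset_Ici.2 h)

end Quantile

namespace IsRegular

variable {μ : Measure ℝ} [IsProbabilityMeasure μ] {a : ℝ} {b : EReal} {f : ℝ → ℝ}

omit [IsProbabilityMeasure μ] in
lemma ae_mem_Icc (h : IsRegular μ a b f) : ∀ᵐ x ∂μ, a ≤ x ∧ (x : EReal) ≤ b := by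
  filter_upwards [h.ae_mem] with x hx
  rcases hx with hx | hx
  · exact ⟨hx.1.le, hx.2.le⟩
  · exact ⟨by rw [← EReal.coe_le_coe_iff, hx]; exact h.left_le_right, hx.le⟩

lemma quantile_eq_one (h : IsRegular μ a b f) {x : ℝ} (hx : x ≤ a) : quantile μ x = 1 := by
  have : μ (Set.Ici x) = 1 := by
    rw [← mem_ae_iff_prob_eq_one measurableSet_Ici]
    filter_upwards [h.ae_mem_Icc] with y hy using hx.trans hy.1
  simp [quantile, measureReal_def, this]

omit [IsProbabilityMeasure μ] in
lemma quantile_eq_zero (h : IsRegular μ a b f) {x : ℝ} (hx : b < x) : quantile μ x = 0 := by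
  have : μ (Set.Ici x) = 0 := by
    rw [measure_eq_zero_iff_ae_notMem]
    filter_upwards [h.ae_mem_Icc] with y hy hxy
    have : (x : EReal) ≤ y := by exact_mod_cast hxy
    exact absurd (this.trans hy.2) (not_le.2 hx)
  simp [quantile, measureReal_def, this]

omit [IsProbabilityMeasure μ] in
lemma measure_eq_lintegral (h : IsRegular μ a b f) {s : Set ℝ} (hs : MeasurableSet s)
    (hsub : s ⊆ valueInterval a b) : μ s = ∫⁻ x in s, ENNReal.ofReal (f x) := by
  have := congrArg (fun ν => ν s) h.restrict_eq
  rwa [Measure.restrict_eq_self _ hsub, withDensity_apply _ hs, Measure.restrict_restrict hs,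
    Set.inter_eq_left.2 hsub] at this

omit [IsProbabilityMeasure μ] in
lemma measure_singleton (h : IsRegular μ a b f) {x : ℝ} (hax : a ≤ x) (hxb : (x : EReal) < b) :
    μ {x} = 0 := by
  rcases hax.eq_or_lt with rfl | hax
  · rw [measure_eq_zero_iff_ae_notMem]
    filter_upwards [h.ae_mem] with y hy hya
    rw [Set.mem_singleton_iff] at hya
    subst hya
    rcases hy with hy | hy
    · exact lt_irrefl _ hy.1
    · exact hxb.ne hy
  · rw [h.measure_eq_lintegral (measurableSet_singleton x)
      (Set.singleton_subset_iff.2 ⟨hax, hxb⟩)]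
    simp

lemma quantile_sub_quantile (h : IsRegular μ a b f) {x y : ℝ} (hax : a ≤ x) (hxy : x < y)
    (hyb : (y : EReal) ≤ b) :
    quantile μ x - quantile μ y = (∫⁻ z in Set.Ioo x y, ENNReal.ofReal (f z)).toReal := by
  have hsub : Set.Ioo x y ⊆ valueInterval a b := fun z hz =>
    ⟨hax.trans_lt hz.1, (EReal.coe_lt_coe_iff.2 hz.2).trans_le hyb⟩
  rw [← h.measure_eq_lintegral measurableSet_Ioo hsub, quantile, quantile, ← measureReal_def,
    ← measureReal_sdiff (Set.Ici_subset_Ici.2 hxy.le) measurableSet_Ici, Set.Ici_sdiff_Ici]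
  rw [measureReal_def, measureReal_def]
  congr 1
  -- The left endpoint is null because it lies below `b`, the only possible atom; a mass at `y = b`
  -- is counted in both quantiles and cancels.
  rw [← Set.Ioo_union_left hxy]
  refine le_antisymm ((measure_union_le _ _).trans ?_) (measure_mono Set.subset_union_left)
  rw [h.measure_singleton hax ((EReal.coe_lt_coe_iff.2 hxy).trans_le hyb), add_zero]

lemma mul_le_quantile_sub (h : IsRegular μ a b f) {x y c : ℝ} (hax : a ≤ x) (hxy : x ≤ y)
    (hyb : (y : EReal) ≤ b) (hc : 0 ≤ c) (hf : ∀ z ∈ Set.Ioo x y, c ≤ f z) :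
    (y - x) * c ≤ quantile μ x - quantile μ y := by
  rcases hxy.eq_or_lt with rfl | hxy
  · simp
  have hsub : Set.Ioo x y ⊆ valueInterval a b := fun z hz =>
    ⟨hax.trans_lt hz.1, (EReal.coe_lt_coe_iff.2 hz.2).trans_le hyb⟩
  rw [h.quantile_sub_quantile hax hxy hyb]
  have hfin : ∫⁻ z in Set.Ioo x y, ENNReal.ofReal (f z) ≠ ⊤ := by
    rw [← h.measure_eq_lintegral measurableSet_Ioo hsub]
    exact measure_ne_top _ _
  rw [← ENNReal.ofReal_le_iff_le_toReal hfin]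
  calc ENNReal.ofReal ((y - x) * c) = ∫⁻ _ in Set.Ioo x y, ENNReal.ofReal c := by
        rw [setLIntegral_const, Real.volume_Ioo, mul_comm, ENNReal.ofReal_mul hc]
    _ ≤ _ := setLIntegral_mono' measurableSet_Ioo fun z hz => ENNReal.ofReal_le_ofReal (hf z hz)

lemma quantile_sub_le_mul (h : IsRegular μ a b f) {x y c : ℝ} (hax : a ≤ x) (hxy : x ≤ y)
    (hyb : (y : EReal) ≤ b) (hc : 0 ≤ c) (hf : ∀ z ∈ Set.Ioo x y, f z ≤ c) :
    quantile μ x - quantile μ y ≤ (y - x) * c := by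
  rcases hxy.eq_or_lt with rfl | hxy
  · simp
  rw [h.quantile_sub_quantile hax hxy hyb]
  refine ENNReal.toReal_le_of_le_ofReal (mul_nonneg (by linarith) hc) ?_
  calc _ ≤ ∫⁻ _ in Set.Ioo x y, ENNReal.ofReal c :=
        setLIntegral_mono' measurableSet_Ioo fun z hz => ENNReal.ofReal_le_ofReal (hf z hz)
    _ = ENNReal.ofReal ((y - x) * c) := by
        rw [setLIntegral_const, Real.volume_Ioo, mul_comm, ENNReal.ofReal_mul (by linarith)]

/-- The profit from a posted price with unit cost `c` decreases where the virtual value exceeds the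
cost. -/
lemma profit_antitone (h : IsRegular μ a b f) {x y c : ℝ} (hax : a ≤ x) (hxy : x ≤ y)
    (hyb : (y : EReal) ≤ b) (hφ : ∀ z ∈ Set.Ioo x y, c ≤ virtualValue μ f z) :
    (y - c) * quantile μ y ≤ (x - c) * quantile μ x := by
  rcases hxy.eq_or_lt with rfl | hxy
  · exact le_rfl
  have hpos : ∀ z ∈ Set.Ioo x y, 0 < f z := fun z hz =>
    h.density_pos z ⟨hax.trans_lt hz.1, (EReal.coe_lt_coe_iff.2 hz.2).trans_le hyb⟩
  have hcz : ∀ z ∈ Set.Ioo x y, c ≤ z := fun z hz => by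
    have h1 := hφ z hz
    have h2 := div_nonneg (quantile_nonneg (μ := μ) z) (hpos z hz).le
    unfold virtualValue at h1
    linarith
  have hcx : c ≤ x := by
    by_contra! hlt
    have hz : (x + min y c) / 2 ∈ Set.Ioo x y := by
      have := lt_min hxy hlt
      have := min_le_left y c
      constructor <;> linarith
    have := hcz _ hz
    have := min_le_right y c
    linarith
  -- Starting at an interior point keeps the margin above `c` positive, since `c = x` is possible.
  have hint : ∀ z ∈ Set.Ioo x y, (y - c) * quantile μ y ≤ (z - c) * quantile μ z := by
    intro x' hx'
    have hcx' : 0 < x' - c := by linarith [hx'.1]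
    refine neg_le_neg_iff.1 (le_of_forall_sub_le (G := fun z => -((z - c) * quantile μ z))
      (m := fun z => z / (x' - c)) hx'.2.le fun u v hu huv hv => ?_)
    have hvc : 0 < v - c := by linarith
    -- A virtual value at least `c` means `f z ≥ q(z) / (z - c)`, so demand falls fast enough for
    -- the profit to decrease up to an error of order `(v - u)²`.
    have hD := h.mul_le_quantile_sub (x := u) (y := v) (c := quantile μ v / (v - c))
      (by linarith [hx'.1]) huv ((EReal.coe_le_coe_iff.2 hv).trans hyb)
      (div_nonneg (quantile_nonneg _) hvc.le) fun z hz => by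
        have hz' : z ∈ Set.Ioo x y := ⟨by linarith [hx'.1, hz.1], by linarith [hz.2]⟩
        have h1 := hφ z hz'
        have h2 : quantile μ z / f z ≤ z - c := by unfold virtualValue at h1; linarith
        rw [div_le_iff₀ (hpos z hz')] at h2
        rw [div_le_iff₀ hvc]
        have h3 : quantile μ v ≤ quantile μ z := quantile_antitone hz.2.le
        nlinarith [hpos z hz', hz.2]
    have hq0 := quantile_nonneg (μ := μ) v
    have hq1 := quantile_le_one (μ := μ) v
    have h1 : (v - u) ^ 2 * (quantile μ v / (v - c)) ≤ (v - u) ^ 2 * (1 / (x' - c)) := by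
      refine mul_le_mul_of_nonneg_left ?_ (sq_nonneg _)
      exact div_le_div₀ zero_le_one hq1 hcx' (by linarith)
    have h2 : (v - c) * (quantile μ v / (v - c)) = quantile μ v := by field_simp
    have h3 := mul_le_mul_of_nonneg_left hD (show 0 ≤ u - c by linarith)
    have h4 : (v - u) * (v / (x' - c) - u / (x' - c)) = (v - u) ^ 2 * (1 / (x' - c)) := by ring
    rw [h4]
    refine le_trans ?_ h1
    nlinarith
  -- Let the interior point tend to `x`; bounding its quantile by that of `x` makes continuity of
  -- the quantile unnecessary.
  refine ge_of_tendsto (f := fun z => (z - c) * quantile μ x) (x := nhdsWithin x (Set.Ioi x)) ?_ ?_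
  · exact ((continuous_id.sub continuous_const).mul continuous_const).continuousWithinAt
  · filter_upwards [Ioo_mem_nhdsGT hxy] with z hz
    exact (hint z hz).trans (mul_le_mul_of_nonneg_left (quantile_antitone hz.1.le)
      (by linarith [hz.1]))

/-- The profit from a posted price with unit cost `c` increases where the virtual value is below the
cost. -/
lemma profit_monotone (h : IsRegular μ a b f) {x y c : ℝ} (hax : a ≤ x) (hxy : x ≤ y)
    (hyb : (y : EReal) ≤ b) (hcx : c < x) (hφ : ∀ z ∈ Set.Ioo x y, virtualValue μ f z ≤ c) :
    (x - c) * quantile μ x ≤ (y - c) * quantile μ y := by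
  have hpos : ∀ z ∈ Set.Ioo x y, 0 < f z := fun z hz =>
    h.density_pos z ⟨hax.trans_lt hz.1, (EReal.coe_lt_coe_iff.2 hz.2).trans_le hyb⟩
  refine le_of_forall_sub_le (G := fun z => (z - c) * quantile μ z)
      (m := fun z => z / (x - c)) hxy fun u v hu huv hv => ?_
  have huc : 0 < u - c := by linarith
  have hD := h.quantile_sub_le_mul (x := u) (y := v) (c := quantile μ u / (u - c))
      (by linarith) huv ((EReal.coe_le_coe_iff.2 hv).trans hyb)
      (div_nonneg (quantile_nonneg _) huc.le) fun z hz => by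
        have hz' : z ∈ Set.Ioo x y := ⟨by linarith [hz.1], by linarith [hz.2]⟩
        have h1 := hφ z hz'
        have h2 : z - c ≤ quantile μ z / f z := by unfold virtualValue at h1; linarith
        rw [le_div_iff₀ (hpos z hz')] at h2
        rw [le_div_iff₀ huc]
        have h3 : quantile μ z ≤ quantile μ u := quantile_antitone hz.1.le
        nlinarith [hpos z hz', hz.1]
  have hq1 := quantile_le_one (μ := μ) u
  have h1 : (v - u) ^ 2 * (quantile μ u / (u - c)) ≤ (v - u) ^ 2 * (1 / (x - c)) := by
    refine mul_le_mul_of_nonneg_left ?_ (sq_nonneg _)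
    exact div_le_div₀ zero_le_one hq1 (by linarith) (by linarith)
  have h2 : (u - c) * (quantile μ u / (u - c)) = quantile μ u := by field_simp
  have h3 := mul_le_mul_of_nonneg_left hD (show 0 ≤ v - c by linarith)
  have h4 : (v - u) * (v / (x - c) - u / (x - c)) = (v - u) ^ 2 * (1 / (x - c)) := by ring
  rw [h4]
  refine le_trans ?_ h1
  nlinarith

/-- A price at which the virtual value crosses the unit cost `c` is optimal. -/
theorem profit_le (h : IsRegular μ a b f) {r c : ℝ} (har : a ≤ r) (hrb : (r : EReal) ≤ b)
    (hcr : c ≤ r) (hlo : ∀ z ∈ valueInterval a b, z < r → virtualValue μ f z ≤ c)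
    (hhi : ∀ z ∈ valueInterval a b, r < z → c ≤ virtualValue μ f z) {θ : ℝ} (hθ : c < θ) :
    (θ - c) * quantile μ θ ≤ (r - c) * quantile μ r := by
  have hmono : ∀ x, a ≤ x → c < x → x ≤ r → (x - c) * quantile μ x ≤ (r - c) * quantile μ r :=
    fun x hax hcx hxr => h.profit_monotone hax hxr hrb hcx fun z hz =>
      hlo z ⟨hax.trans_lt hz.1, (EReal.coe_lt_coe_iff.2 hz.2).trans_le hrb⟩ hz.2
  rcases le_total r θ with hrθ | hrθ
  · rcases le_or_gt (θ : EReal) b with hb | hb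
    · exact h.profit_antitone har hrθ hb fun z hz =>
        hhi z ⟨har.trans_lt hz.1, (EReal.coe_lt_coe_iff.2 hz.2).trans_le hb⟩ hz.1
    · rw [h.quantile_eq_zero hb, mul_zero]
      exact mul_nonneg (by linarith) (quantile_nonneg _)
  · rcases le_total a θ with haθ | haθ
    · exact hmono θ haθ hθ hrθ
    -- Below the support every buyer accepts, so raising the price to `a` only helps.
    · refine le_trans ?_ (hmono a le_rfl (by linarith) har)
      rw [h.quantile_eq_one haθ, h.quantile_eq_one le_rfl]
      linarith

end IsRegular

/-! ### Integrability of the payments -/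

namespace IsPairwiseIndepPrior

variable {n : ℕ} {μ : Measure ℝ} {F : Measure (Fin n → ℝ)} [IsProbabilityMeasure μ]

/-- By independence of the pair, the minimum exceeds `t` with probability `q(t)² ≤ C² / t²`, which
is an integrable tail even when `q(t)` itself decays only like `1 / t`. -/
lemma integrable_max_min (hF : IsPairwiseIndepPrior μ F) {C : ℝ}
    (hC : ∀ τ, 0 < τ → τ * quantile μ τ ≤ C) {i j : Fin n} (hij : i ≠ j) :
    Integrable (fun v => max 0 (min (v i) (v j))) F := by
  have hmeas : Measurable fun v : Fin n → ℝ => max 0 (min (v i) (v j)) :=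
    measurable_const.max ((measurable_pi_apply i).min (measurable_pi_apply j))
  have hnn : ∀ v : Fin n → ℝ, 0 ≤ max 0 (min (v i) (v j)) := fun v => le_max_left _ _
  refine ⟨hmeas.aestronglyMeasurable, ?_⟩
  rw [hasFiniteIntegral_iff_ofReal (Filter.Eventually.of_forall hnn),
    lintegral_eq_lintegral_meas_le F (Filter.Eventually.of_forall hnn) hmeas.aemeasurable]
  have hmeasq : ∀ t : ℝ, 0 < t → F {v | t ≤ max 0 (min (v i) (v j))} =
      ENNReal.ofReal (quantile μ t ^ 2) := by
    intro t ht
    have : {v : Fin n → ℝ | t ≤ max 0 (min (v i) (v j))} = {v | t ≤ v i} ∩ {v | t ≤ v j} := by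
      ext v; simp [not_le.2 ht]
    rw [this, hF.measure_le_apply_inter hij, sq, ENNReal.ofReal_mul (quantile_nonneg t), quantile,
      ofReal_measureReal]
  have hunion : Set.Ioi (0 : ℝ) = Set.Ioc 0 1 ∪ Set.Ioi 1 :=
    (Set.Ioc_union_Ioi_eq_Ioi zero_le_one).symm
  rw [hunion]
  refine (lintegral_union_le _ _ _).trans_lt (ENNReal.add_lt_top.2 ⟨?_, ?_⟩)
  · refine (setLIntegral_mono' measurableSet_Ioc (g := fun _ => 1) fun t ht => ?_).trans_lt ?_
    · rw [hmeasq t ht.1, ENNReal.ofReal_le_one]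
      exact pow_le_one₀ (quantile_nonneg t) (quantile_le_one t)
    · simp
  · have hint : IntegrableOn (fun t : ℝ => C ^ 2 * t ^ (-2 : ℝ)) (Set.Ioi 1) :=
      (integrableOn_Ioi_rpow_of_lt (by norm_num) one_pos).const_mul _
    refine (setLIntegral_mono' measurableSet_Ioi
      (g := fun t => ENNReal.ofReal (C ^ 2 * t ^ (-2 : ℝ))) fun t ht => ?_).trans_lt ?_
    · have ht0 : 0 < t := one_pos.trans ht
      rw [hmeasq t ht0]
      refine ENNReal.ofReal_le_ofReal ?_
      have h1 := pow_le_pow_left₀ (mul_nonneg ht0.le (quantile_nonneg t)) (hC t ht0) 2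
      rw [Real.rpow_neg ht0.le, ← div_eq_mul_inv, le_div_iff₀ (by positivity)]
      norm_num
      linarith [mul_pow t (quantile μ t) 2]
    · exact hint.lintegral_lt_top

theorem integrable_totalPay (hF : IsPairwiseIndepPrior μ F) {r C : ℝ} (hr : 0 ≤ r)
    (hC : ∀ τ, 0 < τ → τ * quantile μ τ ≤ C) :
    Integrable (secondPriceAuction n r).totalPay F := by
  have := hF.isProbabilityMeasure
  have hdom : Integrable (fun v : Fin n → ℝ =>
      r + ∑ i, ∑ j ∈ Finset.univ.erase i, max 0 (min (v i) (v j))) F :=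
    (integrable_const r).add (integrable_finsetSum _ fun i _ => integrable_finsetSum _ fun j hj =>
      hF.integrable_max_min hC (Finset.ne_of_mem_erase hj).symm)
  refine hdom.mono' measurable_secondPriceAuction_totalPay.aestronglyMeasurable
    (Filter.Eventually.of_forall fun v => ?_)
  rw [Real.norm_of_nonneg (secondPriceAuction_totalPay_nonneg hr v)]
  exact totalPay_le hr v

end IsPairwiseIndepPrior

/-! ### Incentive compatible mechanisms for a single buyer -/

/-- The profit, at unit cost `c`, of an incentive compatible and individually rational mechanism for
a single buyer is at most that of the best posted price. -/
theorem integral_payment_le {μ : Measure ℝ} [IsProbabilityMeasure μ] {x p : ℝ → ℝ} {c K : ℝ}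
    (hμ : ∀ᵐ v ∂μ, 0 ≤ v) (hx : Measurable x) (hx0 : ∀ v, 0 ≤ x v) (hx1 : ∀ v, x v ≤ 1)
    (hp : Integrable p μ) (hc : 0 ≤ c) (hK : 0 ≤ K)
    (hIC : ∀ v w, 0 ≤ v → 0 ≤ w → v * x w - p w ≤ v * x v - p v)
    (hIR : ∀ v, 0 ≤ v → 0 ≤ v * x v - p v)
    (hprofit : ∀ θ, c < θ → (θ - c) * quantile μ θ ≤ K) :
    ∫ v, p v ∂μ ≤ c * ∫ v, x v ∂μ + K := by
  have hmono : ∀ v w, 0 ≤ v → v ≤ w → x v ≤ x w := by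
    intro v w hv hvw
    rcases hvw.eq_or_lt with rfl | hlt
    · exact le_rfl
    have h1 := hIC v w hv (hv.trans hvw)
    have h2 := hIC w v (hv.trans hvw) hv
    nlinarith
  -- the smallest value that wins with probability at least `y`
  set Θ : ℝ → ENNReal := fun y => ⨆ z ∈ {z : ℝ | 0 ≤ z ∧ x z < y}, ENNReal.ofReal z with hΘ
  have hΘmono : Monotone Θ := fun y y' hy => biSup_mono fun z hz => ⟨hz.1, hz.2.trans_le hy⟩
  have hΘle : ∀ y v, 0 ≤ v → y ≤ x v → Θ y ≤ ENNReal.ofReal v := by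
    intro y v hv hy
    refine iSup₂_le fun z hz => ENNReal.ofReal_le_ofReal ?_
    by_contra! hlt
    exact absurd (hz.2.trans_le hy) (not_lt.2 (hmono v z hv hlt.le))
  set θ : ℝ → ℝ := fun y => (Θ y).toReal with hθ
  have hθmeas : Measurable θ := hΘmono.measurable.ennreal_toReal
  have hθle : ∀ y v, 0 ≤ v → y ≤ x v → θ y ≤ v := fun y v hv hy =>
    ENNReal.toReal_le_of_le_ofReal hv (hΘle y v hv hy)
  have hleθ : ∀ y v w, 0 ≤ v → y ≤ x v → 0 ≤ w → x w < y → w ≤ θ y := by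
    intro y v w hv hy hw hwy
    rw [hθ, ← ENNReal.ofReal_le_iff_le_toReal ((hΘle y v hv hy).trans_lt ENNReal.ofReal_lt_top).ne]
    exact le_iSup₂ (f := fun z (_ : z ∈ {z : ℝ | 0 ≤ z ∧ x z < y}) => ENNReal.ofReal z) w ⟨hw, hwy⟩
  set e : ℝ → ℝ := fun y => max (θ y - c) 0 with he
  have hemeas : Measurable e := (hθmeas.sub measurable_const).max measurable_const
  have he0 : ∀ y, 0 ≤ e y := fun y => le_max_right _ _
  have hele : ∀ y v, 0 ≤ v → y ≤ x v → e y ≤ v := fun y v hv hy =>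
    max_le (by linarith [hθle y v hv hy]) hv
  have heint : ∀ v, 0 ≤ v → ∀ s t, s ≤ x v → t ≤ x v → IntervalIntegrable e volume s t := by
    intro v hv s t hs ht
    rw [intervalIntegrable_iff]
    refine Measure.integrableOn_of_bounded (M := v) (by simp) hemeas.aestronglyMeasurable ?_
    refine (ae_restrict_iff' measurableSet_uIoc).2 (Filter.Eventually.of_forall fun y hy => ?_)
    rw [Real.norm_of_nonneg (he0 y)]
    exact hele y v hv (hy.2.trans (max_le hs ht))
  -- Envelope argument without derivatives: by incentive compatibility the payment grows by at most
  -- `w (x w - x u)` from `u` to `w`, while thresholds on the levels between `x u` and `x w` are at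
  -- least `u`. The two differ by `(w - u)(x w - x u)`, as `le_of_forall_sub_le` permits. Individual
  -- rationality starts the comparison at `c`.
  have hpoint : ∀ v, 0 ≤ v → p v - c * x v ≤ ∫ y in (0 : ℝ)..x v, e y := by
    intro v hv
    have hnn : ∀ v, 0 ≤ ∫ y in (0 : ℝ)..x v, e y := fun v =>
      intervalIntegral.integral_nonneg (hx0 v) fun y _ => he0 y
    rcases le_total v c with hvc | hvc
    · have h1 := hIR v hv
      have h2 := mul_le_mul_of_nonneg_right hvc (hx0 v)
      linarith [hnn v]
    · have := le_of_forall_sub_le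
        (G := fun v => (∫ y in (0 : ℝ)..x v, e y) - (p v - c * x v)) (m := x) hvc
        fun u w hu huw hw => by
          have hu0 := hc.trans hu
          have hw0 := hu0.trans huw
          have h1 := hIC w u hw0 hu0
          have h2 : ∫ y in (x u)..x w, (u - c) ≤ ∫ y in (x u)..x w, e y := by
            refine intervalIntegral.integral_mono_on_of_le_Ioo (hmono u w hu0 huw)
              intervalIntegrable_const
              (heint w hw0 _ _ (hmono u w hu0 huw) le_rfl) fun y hy => ?_
            exact le_max_of_le_left (by linarith [hleθ y w u hw0 hy.2.le hu0 hy.1])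
          rw [intervalIntegral.integral_const, smul_eq_mul] at h2
          have h3 := intervalIntegral.integral_add_adjacent_intervals
            (heint w hw0 0 (x u) (hx0 w) (hmono u w hu0 huw))
            (heint w hw0 (x u) (x w) (hmono u w hu0 huw) le_rfl)
          linarith
      have h1 := hIR c hc
      have h2 := hnn c
      linarith
  have hxint : Integrable x μ := Integrable.of_bound hx.aestronglyMeasurable 1
    (Filter.Eventually.of_forall fun v => by rw [Real.norm_of_nonneg (hx0 v)]; exact hx1 v)
  -- By Tonelli the profit is an average over levels `y` in `(0, 1]` of profits from posting the
  -- price `θ y`, each at most `K`.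
  have hswap : ∫⁻ v, ENNReal.ofReal (p v - c * x v) ∂μ ≤ ENNReal.ofReal K := by
    calc ∫⁻ v, ENNReal.ofReal (p v - c * x v) ∂μ
        ≤ ∫⁻ v, (∫⁻ y in Set.Ioc (0 : ℝ) 1,
            {q : ℝ × ℝ | q.2 ≤ x q.1}.indicator (fun q => ENNReal.ofReal (e q.2)) (v, y)) ∂μ := by
          refine lintegral_mono_ae ?_
          filter_upwards [hμ] with v hv
          refine (ENNReal.ofReal_le_ofReal (hpoint v hv)).trans ?_
          rw [intervalIntegral.integral_of_le (hx0 v), ofReal_integral_eq_lintegral_ofReal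
            ((intervalIntegrable_iff_integrableOn_Ioc_of_le (hx0 v)).1
              (heint v hv 0 (x v) (hx0 v) le_rfl)) (Filter.Eventually.of_forall he0)]
          calc _ ≤ ∫⁻ y in Set.Ioc 0 (x v), {q : ℝ × ℝ | q.2 ≤ x q.1}.indicator
                  (fun q => ENNReal.ofReal (e q.2)) (v, y) := by
                refine setLIntegral_mono' measurableSet_Ioc fun y hy => ?_
                rw [Set.indicator_of_mem (show (v, y) ∈ {q : ℝ × ℝ | q.2 ≤ x q.1} from hy.2)]
            _ ≤ _ := lintegral_mono_set (Set.Ioc_subset_Ioc_right (hx1 v))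
      _ = ∫⁻ y in Set.Ioc (0 : ℝ) 1, ∫⁻ v,
            {q : ℝ × ℝ | q.2 ≤ x q.1}.indicator (fun q => ENNReal.ofReal (e q.2)) (v, y) ∂μ := by
          refine lintegral_lintegral_swap ?_
          exact ((hemeas.comp measurable_snd).ennreal_ofReal.indicator
            (measurableSet_le measurable_snd (hx.comp measurable_fst))).aemeasurable
      _ ≤ ∫⁻ y in Set.Ioc (0 : ℝ) 1, ENNReal.ofReal K := by
          refine lintegral_mono fun y => ?_
          have hset : MeasurableSet {v | y ≤ x v} := measurableSet_le measurable_const hx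
          have : (fun v => {q : ℝ × ℝ | q.2 ≤ x q.1}.indicator
              (fun q => ENNReal.ofReal (e q.2)) (v, y)) =
              {v | y ≤ x v}.indicator fun _ => ENNReal.ofReal (e y) := by
            ext v; simp [Set.indicator_apply]
          rw [this, lintegral_indicator_const hset]
          -- The first case includes levels that no nonnegative value attains: there `Θ y = ⊤`,
          -- hence `θ y = 0`, and the contribution vanishes.
          rcases le_or_gt (θ y) c with hy | hy
          · rw [he]
            simp only [max_eq_right (sub_nonpos.2 hy), ENNReal.ofReal_zero, zero_mul, zero_le]
          · have hle : μ {v | y ≤ x v} ≤ ENNReal.ofReal (quantile μ (θ y)) := by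
              rw [quantile, ofReal_measureReal]
              refine measure_mono_ae ?_
              filter_upwards [hμ] with v hv hyv
              exact hθle y v hv hyv
            have heq : e y = θ y - c := max_eq_left (by linarith)
            calc _ ≤ ENNReal.ofReal (e y) * ENNReal.ofReal (quantile μ (θ y)) := by gcongr
              _ = ENNReal.ofReal ((θ y - c) * quantile μ (θ y)) := by
                rw [heq, ENNReal.ofReal_mul (by linarith)]
              _ ≤ _ := ENNReal.ofReal_le_ofReal (hprofit _ hy)
      _ = ENNReal.ofReal K := by simp
  have hfin : ∫ v, (p v - c * x v) ∂μ ≤ K := by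
    have hint : Integrable (fun v => p v - c * x v) μ := hp.sub (hxint.const_mul c)
    refine (integral_mono hint hint.pos_part fun v => le_max_left _ _).trans ?_
    rw [integral_eq_lintegral_of_nonneg_ae (f := fun v => max (p v - c * x v) 0)
      (Filter.Eventually.of_forall fun v => le_max_right _ _)
      hint.pos_part.aestronglyMeasurable]
    refine ENNReal.toReal_le_of_le_ofReal hK (le_trans (le_of_eq ?_) hswap)
    refine lintegral_congr fun v => ?_
    rcases le_total 0 (p v - c * x v) with h | h
    · simp [max_eq_left h]
    · simp [max_eq_right h, ENNReal.ofReal_of_nonpos h]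
  rw [integral_sub hp (hxint.const_mul c), integral_const_mul] at hfin
  linarith

/-! ### Truthful auctions under the independent prior -/

section IidPrior

variable {n : ℕ} {μ : Measure ℝ} [IsProbabilityMeasure μ]

instance : IsProbabilityMeasure (iidPrior μ n) := by
  unfold iidPrior
  infer_instance

lemma iidPrior_isPairwiseIndepPrior : IsPairwiseIndepPrior μ (iidPrior μ n) where
  isProbabilityMeasure := inferInstance
  marginal i := (measurePreserving_eval (fun _ : Fin n => μ) i).map_eq
  indep _ _ hij := (iIndepFun_pi (μ := fun _ : Fin n => μ) (X := fun _ x => x)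
    fun _ => measurable_id.aemeasurable).indepFun hij

lemma measurable_update_uncurry (i : Fin n) :
    Measurable fun q : (Fin n → ℝ) × ℝ => Function.update q.1 i q.2 := by
  refine measurable_pi_lambda _ fun j => ?_
  rcases eq_or_ne j i with rfl | hj
  · simpa using measurable_snd
  · simpa [Function.update_of_ne hj, Function.comp_def] using
      (measurable_pi_apply j).comp measurable_fst

/-- Resampling one value does not change the independent prior. -/
lemma measurePreserving_update (i : Fin n) :
    MeasurePreserving (fun q : (Fin n → ℝ) × ℝ => Function.update q.1 i q.2)
      ((iidPrior μ n).prod μ) (iidPrior μ n) := by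
  refine ⟨measurable_update_uncurry i, ?_⟩
  refine (Measure.pi_eq fun s hs => ?_).symm
  rw [Measure.map_apply (measurable_update_uncurry i) (MeasurableSet.univ_pi hs)]
  have : (fun q : (Fin n → ℝ) × ℝ => Function.update q.1 i q.2) ⁻¹' Set.univ.pi s =
      (Set.univ.pi (Function.update s i Set.univ)) ×ˢ s i := by
    ext q
    simp only [Set.mem_preimage, Set.mem_pi, Set.mem_univ, true_imp_iff, Set.mem_prod]
    constructor
    · intro h
      refine ⟨fun j => ?_, by simpa using h i⟩
      rcases eq_or_ne j i with rfl | hj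
      · simp
      · simpa [Function.update_of_ne hj] using h j
    · rintro ⟨h1, h2⟩ j
      rcases eq_or_ne j i with rfl | hj
      · simpa using h2
      · simpa [Function.update_of_ne hj] using h1 j
  rw [this, Measure.prod_prod, iidPrior, Measure.pi_pi,
    ← Finset.prod_erase_mul _ _ (Finset.mem_univ i),
    ← Finset.prod_erase_mul _ (fun j => μ (s j)) (Finset.mem_univ i)]
  rw [Function.update_self, measure_univ, mul_one]
  congr 1
  exact Finset.prod_congr rfl fun j hj => by rw [Function.update_of_ne (Finset.ne_of_mem_erase hj)]

lemma integrable_update {g : (Fin n → ℝ) → ℝ} (hg : Integrable g (iidPrior μ n)) (i : Fin n) :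
    Integrable (fun q : (Fin n → ℝ) × ℝ => g (Function.update q.1 i q.2))
      ((iidPrior μ n).prod μ) :=
  (measurePreserving_update i).integrable_comp_of_integrable hg

lemma integral_update {g : (Fin n → ℝ) → ℝ} (hg : Integrable g (iidPrior μ n)) (i : Fin n) :
    ∫ b, ∫ v, g (Function.update v i b) ∂(iidPrior μ n) ∂μ = ∫ v, g v ∂(iidPrior μ n) := by
  rw [← integral_prod_symm _ (integrable_update hg i),
    ← (measurePreserving_update (μ := μ) i).map_eq,
    integral_map (measurable_update_uncurry i).aemeasurable]
  · rw [(measurePreserving_update (μ := μ) i).map_eq]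
  · rw [(measurePreserving_update (μ := μ) i).map_eq]
    exact hg.aestronglyMeasurable

end IidPrior

namespace Auction.IsTruthful

variable {n : ℕ} {μ : Measure ℝ} [IsProbabilityMeasure μ] {A : Auction n}

omit [IsProbabilityMeasure μ] in
lemma alloc_le_one (hA : A.IsTruthful μ) (b : Fin n → ℝ) (i : Fin n) : A.alloc b i ≤ 1 :=
  (Finset.single_le_sum (f := fun i => A.alloc b i) (fun i _ => hA.alloc_nonneg b i)
    (Finset.mem_univ i)).trans (hA.sum_alloc_le_one b)

lemma integrable_alloc_comp (hA : A.IsTruthful μ) (i : Fin n) {g : (Fin n → ℝ) → Fin n → ℝ}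
    (hg : Measurable g) : Integrable (fun v => A.alloc (g v) i) (iidPrior μ n) :=
  Integrable.of_bound ((hA.measurable_alloc i).comp hg).aestronglyMeasurable 1
    (Filter.Eventually.of_forall fun v => by
      rw [Real.norm_of_nonneg (hA.alloc_nonneg _ i)]
      exact hA.alloc_le_one _ i)

lemma integrable_alloc (hA : A.IsTruthful μ) (i : Fin n) :
    Integrable (fun v => A.alloc v i) (iidPrior μ n) :=
  hA.integrable_alloc_comp i measurable_id

/-- The ex-ante relaxation: the revenue of a truthful auction is bounded by selling separately to
each bidder at unit cost `c`, plus the cost of one item. -/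
theorem revenue_le (hA : A.IsTruthful μ) (hμ : ∀ᵐ v ∂μ, 0 ≤ v) {c K : ℝ} (hc : 0 ≤ c) (hK : 0 ≤ K)
    (hprofit : ∀ θ, c < θ → (θ - c) * quantile μ θ ≤ K) :
    A.revenue (iidPrior μ n) ≤ c + n * K := by
  have hi : ∀ i, ∫ v, A.pay v i ∂(iidPrior μ n) ≤ c * ∫ v, A.alloc v i ∂(iidPrior μ n) + K := by
    intro i
    rw [← integral_update (hA.integrable_pay i) i, ← integral_update (hA.integrable_alloc i) i]
    have hmeas : ∀ b : ℝ, Measurable fun v : Fin n → ℝ => Function.update v i b := fun b =>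
      (measurable_update_uncurry i).comp (measurable_id.prodMk measurable_const)
    refine integral_payment_le (x := A.interimAlloc μ i) (p := A.interimPay μ i) hμ ?_ ?_ ?_ ?_ hc
      hK (hA.incentive_compatible i) (hA.individually_rational i) hprofit
    · exact (((hA.measurable_alloc i).comp
        (measurable_update_uncurry i)).stronglyMeasurable.integral_prod_left').measurable
    · exact fun b => integral_nonneg fun v => hA.alloc_nonneg _ i
    · intro b
      calc A.interimAlloc μ i b ≤ ∫ _, (1 : ℝ) ∂(iidPrior μ n) :=
            integral_mono (hA.integrable_alloc_comp i (hmeas b)) (integrable_const _)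
              fun v => hA.alloc_le_one _ i
        _ = 1 := by simp
    · exact (integrable_update (hA.integrable_pay i) i).integral_prod_right
  have hsum : ∑ i, ∫ v, A.alloc v i ∂(iidPrior μ n) ≤ 1 := by
    rw [← integral_finsetSum _ fun i _ => hA.integrable_alloc i]
    calc _ ≤ ∫ _, (1 : ℝ) ∂(iidPrior μ n) :=
          integral_mono (integrable_finsetSum _ fun i _ => hA.integrable_alloc i)
            (integrable_const _) fun v => hA.sum_alloc_le_one v
      _ = 1 := by simp
  unfold Auction.revenue Auction.totalPay
  rw [integral_finsetSum _ fun i _ => hA.integrable_pay i]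
  calc _ ≤ ∑ i, (c * ∫ v, A.alloc v i ∂(iidPrior μ n) + K) := Finset.sum_le_sum fun i _ => hi i
    _ = c * ∑ i, ∫ v, A.alloc v i ∂(iidPrior μ n) + n * K := by
      rw [Finset.sum_add_distrib, ← Finset.mul_sum]; simp
    _ ≤ c + n * K := by linarith [mul_le_mul_of_nonneg_left hsum hc]

end Auction.IsTruthful

/-- Dominant-strategy truthfulness holds for each profile of the others' bids, so averaging gives
the interim conditions. -/
lemma secondPriceAuction_isTruthful {n : ℕ} {μ : Measure ℝ} [IsProbabilityMeasure μ] {r : ℝ}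
    (hr : 0 ≤ r) (hint : Integrable (secondPriceAuction n r).totalPay (iidPrior μ n)) :
    (secondPriceAuction n r).IsTruthful μ := by
  have hmeas : ∀ (i : Fin n) (b : ℝ), Measurable fun v : Fin n → ℝ => Function.update v i b :=
    fun i b => (measurable_update_uncurry i).comp (measurable_id.prodMk measurable_const)
  have hpay : ∀ (i : Fin n) (b : ℝ), Integrable
      (fun v => (secondPriceAuction n r).pay (Function.update v i b) i) (iidPrior μ n) := by
    intro i b
    refine Integrable.of_bound
      ((measurable_secondPriceAuction_pay i).comp (hmeas i b)).aestronglyMeasurable |b|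
      (Filter.Eventually.of_forall fun v => ?_)
    rw [Real.norm_of_nonneg (secondPriceAuction_pay_nonneg hr _ i)]
    simpa using secondPriceAuction_pay_le (r := r) (Function.update v i b) i
  have halloc : ∀ (i : Fin n) (b : ℝ), Integrable
      (fun v => (secondPriceAuction n r).alloc (Function.update v i b) i) (iidPrior μ n) := by
    intro i b
    refine Integrable.of_bound
      ((measurable_secondPriceAuction_alloc i).comp (hmeas i b)).aestronglyMeasurable 1
      (Filter.Eventually.of_forall fun v => ?_)
    rw [Real.norm_of_nonneg (secondPriceAuction_alloc_nonneg _ i)]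
    exact secondPriceAuction_alloc_le_one _ i
  have hutil : ∀ (i : Fin n) (v b : ℝ),
      v * (secondPriceAuction n r).interimAlloc μ i b - (secondPriceAuction n r).interimPay μ i b =
      ∫ w, (v * (secondPriceAuction n r).alloc (Function.update w i b) i -
        (secondPriceAuction n r).pay (Function.update w i b) i) ∂(iidPrior μ n) := by
    intro i v b
    rw [integral_sub ((halloc i b).const_mul v) (hpay i b), integral_const_mul]
    rfl
  refine ⟨measurable_secondPriceAuction_alloc, measurable_secondPriceAuction_pay,
    secondPriceAuction_alloc_nonneg, secondPriceAuction_sum_alloc_le_one, fun i => ?_,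
    fun i b _ => hpay i b, fun i v b _ _ => ?_, fun i v _ => ?_⟩
  · refine hint.mono' (measurable_secondPriceAuction_pay i).aestronglyMeasurable
      (Filter.Eventually.of_forall fun v => ?_)
    rw [Real.norm_of_nonneg (secondPriceAuction_pay_nonneg hr v i)]
    exact secondPriceAuction_pay_le_totalPay hr v i
  · rw [hutil, hutil]
    exact integral_mono (((halloc i b).const_mul v).sub (hpay i b))
      (((halloc i v).const_mul v).sub (hpay i v))
      fun w => secondPriceAuction_utility_le w i v b
  · rw [hutil]
    exact integral_nonneg fun w => secondPriceAuction_utility_nonneg w i v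

/-! ### The price at which one value is expected to exceed -/

section ExAntePrice

variable {μ : Measure ℝ} [IsProbabilityMeasure μ]

/-- Above some price the expected number of values falls below one. -/
lemma exists_price {n : ℕ} {r C : ℝ} (hC : ∀ τ, 0 < τ → τ * quantile μ τ ≤ C)
    (hs : 1 ≤ n * quantile μ r) :
    ∃ P, r ≤ P ∧ 1 ≤ n * quantile μ P ∧ ∀ τ, P < τ → n * quantile μ τ < 1 := by
  set S := {τ : ℝ | 1 ≤ n * quantile μ τ} with hS
  have hrS : r ∈ S := hs
  have hbdd : BddAbove S := by
    refine ⟨max 0 (n * C), fun τ hτ => ?_⟩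
    rcases le_or_gt τ 0 with h | h
    · exact le_max_of_le_left h
    · refine le_max_of_le_right ?_
      have h1 := mul_le_mul_of_nonneg_left (hC τ h) (Nat.cast_nonneg (α := ℝ) n)
      have h2 := mul_le_mul_of_nonneg_left (show (1 : ℝ) ≤ n * quantile μ τ from hτ) h.le
      linarith
  -- The supremum is attained because `q`, defined with closed half-lines, is left-continuous.
  refine ⟨sSup S, le_csSup hbdd hrS, ?_, fun τ hτ => ?_⟩
  · obtain ⟨u, hu, hlim, huS⟩ := exists_seq_tendsto_sSup ⟨r, hrS⟩ hbdd
    have hInter : Set.Ici (sSup S) = ⋂ k, Set.Ici (u k) := by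
      ext z
      simp only [Set.mem_Ici, Set.mem_iInter]
      exact ⟨fun h k => (le_csSup hbdd (huS k)).trans h, fun h => le_of_tendsto' hlim h⟩
    have htend : Filter.Tendsto (fun k => μ (Set.Ici (u k))) Filter.atTop
        (nhds (μ (Set.Ici (sSup S)))) := by
      rw [hInter]
      exact tendsto_measure_iInter_atTop (fun k => measurableSet_Ici.nullMeasurableSet)
        (fun i j hij => Set.Ici_subset_Ici.2 (hu hij)) ⟨0, measure_ne_top _ _⟩
    have htend' : Filter.Tendsto (fun k => n * quantile μ (u k)) Filter.atTop
        (nhds (n * quantile μ (sSup S))) :=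
      ((ENNReal.tendsto_toReal (measure_ne_top _ _)).comp htend).const_mul _
    exact ge_of_tendsto' htend' huS
  · by_contra! h
    exact absurd (le_csSup hbdd h) (not_le.2 hτ)

/-- Below `b` there is no atom, so `q` is right-continuous at `P` and the strict bounds above `P`
pass to the limit. -/
lemma IsRegular.mul_quantile_le_one {a : ℝ} {b : EReal} {f : ℝ → ℝ} (h : IsRegular μ a b f) {n : ℕ}
    {P : ℝ} (haP : a ≤ P) (hPb : (P : EReal) < b) (hlt : ∀ τ, P < τ → n * quantile μ τ < 1) :
    n * quantile μ P ≤ 1 := by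
  have hunion : Set.Ioi P = ⋃ k : ℕ, Set.Ici (P + 1 / ((k : ℝ) + 1)) := by
    ext z
    simp only [Set.mem_Ioi, Set.mem_iUnion, Set.mem_Ici]
    constructor
    · intro hz
      obtain ⟨k, hk⟩ := exists_nat_one_div_lt (sub_pos.2 hz)
      exact ⟨k, by linarith⟩
    · rintro ⟨k, hk⟩
      have : (0 : ℝ) < 1 / ((k : ℝ) + 1) := Nat.one_div_pos_of_nat
      linarith
  have hmeas : μ (Set.Ici P) = μ (Set.Ioi P) := by
    rw [← Set.Ioi_union_left]
    refine le_antisymm ((measure_union_le _ _).trans ?_) (measure_mono Set.subset_union_left)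
    rw [h.measure_singleton haP hPb, add_zero]
  have htend : Filter.Tendsto (fun k : ℕ => μ (Set.Ici (P + 1 / ((k : ℝ) + 1)))) Filter.atTop
      (nhds (μ (Set.Ici P))) := by
    rw [hmeas, hunion]
    refine tendsto_measure_iUnion_atTop fun i j hij => Set.Ici_subset_Ici.2 ?_
    have := Nat.one_div_le_one_div (α := ℝ) hij
    linarith
  have htend' : Filter.Tendsto (fun k : ℕ => n * quantile μ (P + 1 / ((k : ℝ) + 1))) Filter.atTop
      (nhds (n * quantile μ P)) :=
    ((ENNReal.tendsto_toReal (measure_ne_top _ _)).comp htend).const_mul _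
  refine le_of_tendsto' htend' fun k => (hlt _ ?_).le
  have : (0 : ℝ) < 1 / ((k : ℝ) + 1) := Nat.one_div_pos_of_nat
  linarith

end ExAntePrice

theorem truthful_revenue_le {n : ℕ} {μ : Measure ℝ} [IsProbabilityMeasure μ] {a : ℝ} {b : EReal}
    {f : ℝ → ℝ} {r : ℝ} (h : IsRegular μ a b f) (hr : IsMonopolyReserve μ a b f r)
    {F : Measure (Fin n → ℝ)} (hF : IsPairwiseIndepPrior μ F)
    (hint : Integrable (secondPriceAuction n r).totalPay F) {A : Auction n}
    (hA : A.IsTruthful μ) :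
    A.revenue (iidPrior μ n) ≤ 2.62 * (secondPriceAuction n r).revenue F := by
  have hr0 : 0 ≤ r := h.left_nonneg.trans hr.left_le
  have hμ : ∀ᵐ v ∂μ, 0 ≤ v := by
    filter_upwards [h.ae_mem_Icc] with v hv using h.left_nonneg.trans hv.1
  have hmono : ∀ θ, 0 < θ → (θ - 0) * quantile μ θ ≤ (r - 0) * quantile μ r := fun θ hθ =>
    h.profit_le hr.left_le hr.le_right hr0 hr.nonpos_of_lt hr.nonneg_of_gt hθ
  have hrev0 : 0 ≤ (secondPriceAuction n r).revenue F :=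
    integral_nonneg fun v => secondPriceAuction_totalPay_nonneg hr0 v
  rcases le_or_gt (n * quantile μ r) 1 with hs | hs
  · have h1 := hA.revenue_le hμ le_rfl (by simpa using mul_nonneg hr0 (quantile_nonneg r)) hmono
    have h2 := hF.mul_quantile_le_two_mul_revenue hr0 hs hint
    norm_num at h1 ⊢
    linarith
  obtain ⟨P, hrP, hP1, hlt⟩ := exists_price (fun τ hτ => by simpa using hmono τ hτ) hs.le
  have hn : (0 : ℝ) ≤ n := Nat.cast_nonneg n
  have haP : a ≤ P := hr.left_le.trans hrP
  have hPb : (P : EReal) ≤ b := by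
    by_contra! hlt'
    rw [h.quantile_eq_zero hlt', mul_zero] at hP1
    exact absurd hP1 (by norm_num)
  have hupper : A.revenue (iidPrior μ n) ≤ P := by
    rcases hPb.eq_or_lt with hPb' | hPb'
    -- If `P` is the upper endpoint, no price above the unit cost `P` ever sells, so the separate
    -- profits vanish.
    · have := hA.revenue_le hμ (c := P) (K := 0) (hr0.trans hrP) le_rfl fun θ hθ => by
        rw [h.quantile_eq_zero (hPb' ▸ EReal.coe_lt_coe_iff.2 hθ), mul_zero]
      simpa using this
    · have hle := h.mul_quantile_le_one haP hPb' hlt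
      have heq : n * quantile μ P = 1 := le_antisymm hle hP1
      have hrP' : r < P := by
        refine lt_of_le_of_ne hrP fun he => ?_
        rw [he] at hs
        linarith
      have hPmem : P ∈ valueInterval a b := ⟨hr.left_le.trans_lt hrP', hPb'⟩
      -- With the virtual value at `P` as unit cost, monotonicity makes `P` the optimal price. As `n
      -- q(P) = 1`, the bound collapses to `c + (P - c) = P`.
      set c := virtualValue μ f P with hc
      have hc0 : 0 ≤ c := hr.nonneg_of_gt P hPmem hrP'
      have hcP : c ≤ P := by
        have := div_nonneg (quantile_nonneg (μ := μ) P) (h.density_pos P hPmem).le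
        rw [hc, virtualValue]
        linarith
      have := hA.revenue_le hμ hc0 (K := (P - c) * quantile μ P)
        (mul_nonneg (by linarith) (quantile_nonneg P)) fun θ hθ =>
          h.profit_le haP hPb hcP
            (fun z hz hzP => h.monotone_virtualValue hz hPmem hzP.le)
            (fun z hz hzP => h.monotone_virtualValue hPmem hz hzP.le) hθ
      calc _ ≤ _ := this
        _ = c + (P - c) * (n * quantile μ P) := by ring
        _ = P := by rw [heq]; ring
  rcases (hr0.trans hrP).eq_or_lt with hP0 | hP0
  · rw [← hP0] at hupper
    exact hupper.trans (mul_nonneg (by norm_num) hrev0)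
  refine hupper.trans (hF.le_mul_revenue hr0 hP0 hrP (fun τ hrτ hτP => ?_) hint)
  -- Above the monopoly reserve the virtual value is nonnegative, so `τ q(τ)` decreases up to `P`,
  -- where `n q(P) ≥ 1`.
  have h1 := h.profit_antitone (c := 0) (hr.left_le.trans hrτ) hτP hPb fun z hz =>
    hr.nonneg_of_gt z ⟨(hr.left_le.trans hrτ).trans_lt hz.1,
      (EReal.coe_lt_coe_iff.2 hz.2).trans_le hPb⟩ (hrτ.trans_lt hz.1)
  rw [sub_zero, sub_zero] at h1
  calc P = P * 1 := (mul_one P).symm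
    _ ≤ P * (n * quantile μ P) := mul_le_mul_of_nonneg_left hP1 hP0.le
    _ = n * (P * quantile μ P) := by ring
    _ ≤ n * (τ * quantile μ τ) := mul_le_mul_of_nonneg_left h1 hn
    _ = τ * (n * quantile μ τ) := by ring

end PairwiseAuction

theorem mainTheorem3 :
    ∃ c : ℝ, c < 2.63 ∧
      ∀ (n : ℕ) (μ : MeasureTheory.Measure ℝ) [MeasureTheory.IsProbabilityMeasure μ]
        (a : ℝ) (b : EReal) (f : ℝ → ℝ) (r : ℝ),
        PairwiseAuction.IsRegular μ a b f →
        PairwiseAuction.IsMonopolyReserve μ a b f r →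
        ∀ F : MeasureTheory.Measure (Fin n → ℝ), PairwiseAuction.IsPairwiseIndepPrior μ F →
          MeasureTheory.Integrable (PairwiseAuction.secondPriceAuction n r).totalPay F ∧
          MeasureTheory.Integrable (PairwiseAuction.secondPriceAuction n r).totalPay
            (PairwiseAuction.iidPrior μ n) ∧
          (PairwiseAuction.secondPriceAuction n r).revenue (PairwiseAuction.iidPrior μ n) ≤
            c * (PairwiseAuction.secondPriceAuction n r).revenue F ∧
          PairwiseAuction.optimalRevenue μ n ≤
            ((c * (PairwiseAuction.secondPriceAuction n r).revenue F : ℝ) : EReal) := by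
  refine ⟨2.62, by norm_num, fun n μ _ a b f r h hr F hF => ?_⟩
  have hr0 : 0 ≤ r := h.left_nonneg.trans hr.left_le
  have hC : ∀ τ, 0 < τ → τ * PairwiseAuction.quantile μ τ ≤ r * PairwiseAuction.quantile μ r :=
    fun τ hτ => by
      simpa using h.profit_le hr.left_le hr.le_right hr0 hr.nonpos_of_lt hr.nonneg_of_gt hτ
  have hF' := hF.integrable_totalPay hr0 hC
  have hiid := PairwiseAuction.iidPrior_isPairwiseIndepPrior (n := n) (μ := μ)
    |>.integrable_totalPay hr0 hC
  -- The auction is itself truthful, so its revenue under independence obeys the bound proved for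
  -- all truthful auctions.
  refine ⟨hF', hiid, PairwiseAuction.truthful_revenue_le h hr hF hF'
    (PairwiseAuction.secondPriceAuction_isTruthful hr0 hiid), ?_⟩
  exact iSup₂_le fun A hA =>
    EReal.coe_le_coe_iff.2 (PairwiseAuction.truthful_revenue_le h hr hF hF' hA)
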